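/- Let $m\ge 0$, $n=2^m$, and let $Sp(2n)=\{U\in U(2n): U\Delta U^{t}=\Delta\}$ with $\Delta=\begin{pmatrix}0&-\mathbb 1\\ \mathbb 1&0\end{pmatrix}$ acting on the virtual space $\mathbb C^{2n}=(\mathbb C^2)^{\otimes m}\otimes\mathbb C^2$ of $m+1$ qubits (the last factor labels the two blocks of $\Delta$). The $Sp(2n)$ AKLT state on $N$ sites with input $|L\rangle\in\mathbb C^{2n}$ is the valence-bond state in which every site carries two virtual spins $\mathbb C^{2n}$, the left virtual spin of the first site is in the state $|L\rangle$, the right virtual spin of each site forms the singlet $\frac1{\sqrt{2n}}\sum_{a,b}\Delta_{ab}|a\rangle|b\rangle$ with the left virtual spin of the next site (for the last site: with a free edge spin), and the two virtual spins of each site are projected onto $\mathrm{Sym}^2(\mathbb C^{2n})$. An element $g\in Sp(2n)$ acts on a site by $U(g)=g\otimes g$. Call a tensor product of $m$ matrices from $\{\mathbb 1,X,Y,Z\}$ of type $\mathcal Y$ if it has an odd number of factors $Y$, of type $\mathcal X$ if it has an even number of factors $Y$ and is not diagonal, and of type $\mathcal Z$ if it is diagonal and not the identity. Let $\{N_a\}$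 be the family of all $A\otimes\sigma_k$ with $A$ of type $\mathcal X$ or $\mathcal Z$ or $A=\mathbb 1$ and $\sigma_k\in\{X,Y,Z\}$, and all $A\otimes\mathbb 1_2$ with $A$ of type $\mathcal Y$. Then the following holds. 1. (Representations.) The on-site space $\mathrm{Sym}^2(\mathbb C^{2n})$ has dimension $n(2n+1)$. The AKLT state is a matrix product state on the virtual space $\mathbb C^{2n}$: projecting the sites onto $s_1,\dots,s_N\in \mathrm{Sym}^2(\mathbb C^{2n})$, regarded as symmetric matrices, leaves the edge spin in the state $K(s_N)\cdots K(s_1)|L\rangle$ with $K(s)=-\frac1{\sqrt{2n}}\Delta\bar s$. The map $K$ is a bijection onto $\mathfrak{sp}(2n,\mathbb C)$, and $K(U(g)s)=gK(s)g^\dagger$ for $g\in Sp(2n)$, so the sites carry the adjoint representation. 2. (Pauli generators.) The real spans of the Pauli strings of types $\mathcal X,\mathcal Y,\mathcal Z$ are those of the generalized Gell-Mann matrices $X_{ij}=\frac12(E_{ij}+E_{ji})$, $Y_{ij}=\frac{-i}2(E_{ij}-E_{ji})$ $(i<j)$ and $Z_j=\frac1{\sqrt{2j(j-1)}}\bigl(\sum_{\ell<j}E_{\ell\ell}-(j-1)E_{jj}\bigr)$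 $(2\le j\le n)$ of $SU(n)$, respectively. There are $n(2n+1)$ operators $N_a$. The on-site vectors $|a\rangle=\frac1{\sqrt{2n}}\overline{\Delta N_a}$ form an orthonormal basis of the on-site space, in which the Kraus operators are $K(|a\rangle)=\frac1{2n}N_a$. For $g\in Sp(2n)$ the matrix $u_{ab}(g)=\mathrm{tr}(N_a^\dagger gN_bg^\dagger)/2n$ is unitary, $\langle a|U(g)=\sum_b u_{ab}(g)\langle b|$, and $\sum_b u_{ab}(g)N_b=g^\dagger N_ag$. 3. (Counts.) A string of type $\mathcal X$ commutes with exactly $n^2/4$ strings of type $\mathcal X$, $n^2/4-n/2$ of type $\mathcal Y$, and $n/2-1$ of type $\mathcal Z$. A string of type $\mathcal Y$ commutes with exactly $n^2/4$ strings of type $\mathcal Y$, $n^2/4-n/2$ of type $\mathcal X$, and $n/2-1$ of type $\mathcal Z$. A string of type $\mathcal Z$ commutes with exactly $n^2/4-n/2$ strings of each of the types $\mathcal X$ and $\mathcal Y$. 4. (Success probability.) Let the sites be measured one after the other in orthonormal bases with bras $\langle a|U(g)$, $g\in Sp(2n)$, where $g$ may depend on the earlier outcomes, on a nonzero input. Every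 string of $N$ outcomes has Born probability $(n(2n+1))^{-N}$. Let $\sin\theta\ne0$, and let a site be measured with $g=e^{-i(\theta/2)N_a}$. The outcome $b$ executes on the virtual space the operator $\frac{1}{2n}g^\dagger N_b g$, which is proportional to $N_be^{-i\theta N_a}$ (the gate $e^{-i\theta N_a}$ with byproduct $N_b$: success) if and only if $N_b$ anticommutes with $N_a$, and equals $\frac1{2n}N_b$ (identity up to byproduct) otherwise. Given any earlier outcomes, the probability of success is $\dfrac{n+1}{2n+1}$. 5. (Gate set.) The gates that can be executed in this way, up to a phase and a Pauli byproduct, form $Sp(2n)$. That is: the gates $e^{-i\theta N_a}$ generate $Sp(2n)$; for each $V\in Sp(2n)$ there is an adaptive rule, which measures every site in a basis rotated by some $e^{-i\theta N_a}$, such that for every nonzero input the probability that the operator induced by the first $N$ outcomes is $cBV$, with $c\ne0$ and $B$ a tensor product of Pauli matrices, tends to $1$ as $N\to\infty$; and if, under any adaptive rule with bases rotated by elements of $Sp(2n)$, some outcomes induce $cBV$ with $c\neq 0$, $B$ a tensor product of Pauli matrices and $V$ unitary, then $zV\in Sp(2n)$ for some phase $z$. -/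

import Mathlib

open Matrix Filter Topology

noncomputable section

namespace SpAKLT

/-! ## The compact symplectic group, and the valence-bond-solid state it defines

The virtual space is `ℂ^{2n}`, with index type `l ⊕ l`, `n = |l|`. The symplectic form is
`Matrix.J l ℂ = [[0, -1], [1, 0]]`. -/

section VBS

variable (l : Type) [Fintype l] [DecidableEq l]

/-- `Sp(2n) = U(2n) ∩ Sp(2n, ℂ)`. -/
def CSp : Submonoid (Matrix (l ⊕ l) (l ⊕ l) ℂ) :=
  Matrix.unitaryGroup (l ⊕ l) ℂ ⊓ Matrix.symplecticGroup l ℂ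

/-- The normalized `Sp(2n)`-singlet of two virtual spins; the entry `(a, b)` of the matrix is the
coefficient of `|a⟩|b⟩`. -/
def singlet : Matrix (l ⊕ l) (l ⊕ l) ℂ :=
  ((Real.sqrt (Fintype.card (l ⊕ l)) : ℂ))⁻¹ • Matrix.J l ℂ

/-- The on-site space `Sym²(ℂ^{2n})`, inside the space of two virtual spins (a matrix `s` stands
for `∑ s a b |a⟩|b⟩`). -/
def onSite : Submodule ℂ (Matrix (l ⊕ l) (l ⊕ l) ℂ) where
  carrier := {s | sᵀ = s}
  add_mem' := by
    intro a b ha hb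
    simp only [Set.mem_ofPred_eq] at ha hb ⊢
    rw [Matrix.transpose_add, ha, hb]
  zero_mem' := by simp
  smul_mem' := by
    intro c a ha
    simp only [Set.mem_ofPred_eq] at ha ⊢
    rw [Matrix.transpose_smul, ha]

variable {l}

/-- The on-site action `g ⊗ g` of `g` on two virtual spins. -/
def siteSym (g s : Matrix (l ⊕ l) (l ⊕ l) ℂ) : Matrix (l ⊕ l) (l ⊕ l) ℂ := g * s * gᵀ

/-- `N` sites with two virtual spins each, followed by one edge spin, before the on-site
projection. The left spin of the first site is in the state `L`; the right spin of every site is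
in a singlet with the left spin of the next one, and that of the last site with the edge spin. -/
def bonds (N : ℕ) (L : l ⊕ l → ℂ) (x : Fin N → (l ⊕ l) × (l ⊕ l)) (e : l ⊕ l) : ℂ :=
  let left : Fin (N + 1) → l ⊕ l := Fin.snoc (fun k => (x k).1) e
  L (left 0) * ∏ k : Fin N, singlet l (x k).2 (left k.succ)

/-- The `Sp(2n)` AKLT state with input `L` (not normalized): the two spins of every site are
projected onto the symmetric subspace `Sym²(ℂ^{2n})`, by averaging over the swaps. -/
def aklt (N : ℕ) (L : l ⊕ l → ℂ) (x : Fin N → (l ⊕ l) × (l ⊕ l)) (e : l ⊕ l) : ℂ :=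
  (1 / 2 : ℂ) ^ N *
    ∑ τ : Fin N → Bool, bonds N L (fun k => if τ k then (x k).swap else x k) e

/-- The (unnormalized) state of the edge spin after projection of the sites onto the on-site
vectors `s 0, …, s (N - 1)`. -/
def contract {N : ℕ} (s : Fin N → Matrix (l ⊕ l) (l ⊕ l) ℂ)
    (Ψ : (Fin N → (l ⊕ l) × (l ⊕ l)) → l ⊕ l → ℂ) (e : l ⊕ l) : ℂ :=
  ∑ x : Fin N → (l ⊕ l) × (l ⊕ l),
    (∏ k, starRingEnd ℂ (s k (x k).1 (x k).2)) * Ψ x e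

/-- The operator on the virtual space induced by projection of one site onto the on-site
vector `s`. -/
def krausOp (s : Matrix (l ⊕ l) (l ⊕ l) ℂ) : Matrix (l ⊕ l) (l ⊕ l) ℂ :=
  -((Real.sqrt (Fintype.card (l ⊕ l)) : ℂ))⁻¹ • (Matrix.J l ℂ * s.map (starRingEnd ℂ))

/-- `A ⊗ σ`, where the last tensor factor `ℂ²` labels the two blocks of `l ⊕ l`. -/
def tensorLast (A : Matrix l l ℂ) (σ : Matrix (Fin 2) (Fin 2) ℂ) : Matrix (l ⊕ l) (l ⊕ l) ℂ :=
  Matrix.fromBlocks (σ 0 0 • A) (σ 0 1 • A) (σ 1 0 • A) (σ 1 1 • A)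

end VBS

/-! ## Pauli strings and generators -/

/-- Computational basis states of `m` qubits; there are `2 ^ m` of them. -/
abbrev Qubits (m : ℕ) : Type := Fin m → Fin 2

/-- `𝟙, X, Y, Z`. -/
def pauli : Fin 4 → Matrix (Fin 2) (Fin 2) ℂ :=
  ![1, !![0, 1; 1, 0], !![0, -Complex.I; Complex.I, 0], !![1, 0; 0, -1]]

/-- Tensor product of `m` Pauli matrices. -/
def pauliString {m : ℕ} (p : Fin m → Fin 4) : Matrix (Qubits m) (Qubits m) ℂ :=
  Matrix.of fun x y => ∏ k, pauli (p k) (x k) (y k)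

/-- Tensor product of `m + 1` Pauli matrices, on the virtual space of `m + 1` qubits. -/
def pauliOp {m : ℕ} (a : (Fin m → Fin 4) × Fin 4) :
    Matrix (Qubits m ⊕ Qubits m) (Qubits m ⊕ Qubits m) ℂ :=
  tensorLast (pauliString a.1) (pauli a.2)

/-- Strings with an even number of `Y`, that are not diagonal. -/
def xStrings (m : ℕ) : Finset (Fin m → Fin 4) :=
  Finset.univ.filter fun p =>
    Even (Finset.univ.filter fun k => p k = 2).card ∧ ∃ k, p k = 1 ∨ p k = 2

/-- Strings with an odd number of `Y`. -/
def yStrings (m : ℕ) : Finset (Fin m → Fin 4) :=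
  Finset.univ.filter fun p => Odd (Finset.univ.filter fun k => p k = 2).card

/-- Strings of `𝟙` and `Z`, other than the identity. -/
def zStrings (m : ℕ) : Finset (Fin m → Fin 4) :=
  Finset.univ.filter fun p => (∀ k, p k = 0 ∨ p k = 3) ∧ ∃ k, p k = 3

/-- The labels of the Pauli generators
`{X-type ⊗ σₖ, Y-type ⊗ 𝟙, Z-type ⊗ σₖ, 𝟙 ⊗ σₖ}` of `Sp(2n)`, `n = 2 ^ m`. -/
def genLabels (m : ℕ) : Finset ((Fin m → Fin 4) × Fin 4) :=
  (xStrings m ∪ zStrings m ∪ {fun _ => 0}) ×ˢ {1, 2, 3} ∪ yStrings m ×ˢ {0}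

/-- The index type of the generators, which is also the set of outcomes of an on-site
measurement. -/
abbrev Gen (m : ℕ) : Type := {a : (Fin m → Fin 4) × Fin 4 // a ∈ genLabels m}

/-- The generator `N_a`. -/
def gen {m : ℕ} (a : Gen m) : Matrix (Qubits m ⊕ Qubits m) (Qubits m ⊕ Qubits m) ℂ :=
  pauliOp a.1

/-- The generalized Gell-Mann matrix `X_{ij}` of `SU(n)`. -/
def gellMannX {n : ℕ} (i j : Fin n) : Matrix (Fin n) (Fin n) ℂ :=
  (1 / 2 : ℂ) • (Matrix.single i j 1 + Matrix.single j i 1)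

/-- The generalized Gell-Mann matrix `Y_{ij}` of `SU(n)`. -/
def gellMannY {n : ℕ} (i j : Fin n) : Matrix (Fin n) (Fin n) ℂ :=
  (-Complex.I / 2) • (Matrix.single i j 1 - Matrix.single j i 1)

/-- The diagonal generalized Gell-Mann matrix of `SU(n)`; with rows numbered from `0`, the
matrix numbered `j ≥ 1` here is the one usually written `Z_{j+1}`. -/
def gellMannZ {n : ℕ} (j : Fin n) : Matrix (Fin n) (Fin n) ℂ :=
  ((Real.sqrt (2 * ((j : ℝ) + 1) * (j : ℝ)) : ℂ))⁻¹ •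
    ((∑ i ∈ Finset.univ.filter (fun i : Fin n => i < j), Matrix.single i i 1) -
      ((j : ℕ) : ℂ) • Matrix.single j j 1)

/-- An operator on `ℂ^{2^m}` as an operator on `m` qubits. -/
def toQubits {m : ℕ} (A : Matrix (Fin (2 ^ m)) (Fin (2 ^ m)) ℂ) :
    Matrix (Qubits m) (Qubits m) ℂ :=
  Matrix.reindex finFunctionFinEquiv.symm finFunctionFinEquiv.symm A

/-! ## Measurements and gates -/

section MBQC

variable {m : ℕ}

/-- The on-site vector `|a⟩`, `a` a generator. -/
def siteVec (a : Gen m) : Matrix (Qubits m ⊕ Qubits m) (Qubits m ⊕ Qubits m) ℂ :=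
  ((Real.sqrt (Fintype.card (Qubits m ⊕ Qubits m)) : ℂ))⁻¹ •
    (Matrix.J (Qubits m) ℂ * gen a).map (starRingEnd ℂ)

/-- The measurement basis rotated by the on-site symmetry operator of `g`, with bras
`⟨a| U(g)`. -/
def rotVec (g : Matrix (Qubits m ⊕ Qubits m) (Qubits m ⊕ Qubits m) ℂ) (a : Gen m) :
    Matrix (Qubits m ⊕ Qubits m) (Qubits m ⊕ Qubits m) ℂ :=
  siteSym gᴴ (siteVec a)

/-- The matrix `u_{ab}(g) = tr (N_a† g N_b g†) / 2n` of `g` in the adjoint representation. -/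
def adjMatrix (g : Matrix (Qubits m ⊕ Qubits m) (Qubits m ⊕ Qubits m) ℂ) :
    Matrix (Gen m) (Gen m) ℂ :=
  Matrix.of fun a b =>
    ((gen a)ᴴ * g * gen b * gᴴ).trace / (Fintype.card (Qubits m ⊕ Qubits m) : ℂ)

/-- The gate `exp(-i θ N_a)`. -/
def expGate (a : Gen m) (θ : ℝ) : Matrix (Qubits m ⊕ Qubits m) (Qubits m ⊕ Qubits m) ℂ :=
  NormedSpace.exp ((-(Complex.I * (θ : ℂ))) • gen a)

/-- An adaptive rule: the rotation of the basis in which the next site is measured, as a function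
of the list of all earlier outcomes (the earliest one first). -/
abbrev Rule (m : ℕ) : Type :=
  List (Gen m) → Matrix (Qubits m ⊕ Qubits m) (Qubits m ⊕ Qubits m) ℂ

/-- All bases are rotated by symmetries. -/
def Rule.IsSymmetric (π : Rule m) : Prop := ∀ h, π h ∈ CSp (Qubits m)

/-- All bases are rotated by symmetries of the form `exp(-i θ N_a)`. -/
def Rule.IsElementary (π : Rule m) : Prop := ∀ h, ∃ (a : Gen m) (θ : ℝ), π h = expGate a θ

/-- The on-site vectors that the sites are projected onto if the outcomes are `i`. -/
def Rule.vecs (π : Rule m) {N : ℕ} (i : Fin N → Gen m) (k : Fin N) :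
    Matrix (Qubits m ⊕ Qubits m) (Qubits m ⊕ Qubits m) ℂ :=
  rotVec (π ((List.ofFn i).take k)) (i k)

/-- The (unnormalized) state of the edge spin after the outcomes `i`. -/
def Rule.out (π : Rule m) (L : Qubits m ⊕ Qubits m → ℂ) {N : ℕ} (i : Fin N → Gen m) :
    Qubits m ⊕ Qubits m → ℂ :=
  contract (π.vecs i) (aklt N L)

/-- Born probability of the outcomes `i` if the `N` sites of the AKLT state are measured. -/
def Rule.prob (π : Rule m) (L : Qubits m ⊕ Qubits m → ℂ) {N : ℕ} (i : Fin N → Gen m) : ℝ :=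
  (∑ e, ‖π.out L i e‖ ^ 2) /
    ∑ x : Fin N → (Qubits m ⊕ Qubits m) × (Qubits m ⊕ Qubits m), ∑ e, ‖aklt N L x e‖ ^ 2

/-- With the outcomes `i`, the gate `V` has been executed on every input, up to a scalar and a
byproduct operator that is a tensor product of Pauli matrices. -/
def Rule.Executes (π : Rule m) {N : ℕ} (i : Fin N → Gen m)
    (V : Matrix (Qubits m ⊕ Qubits m) (Qubits m ⊕ Qubits m) ℂ) : Prop :=
  ∃ (b : (Fin m → Fin 4) × Fin 4) (c : ℂ), c ≠ 0 ∧
    ∀ L : Qubits m ⊕ Qubits m → ℂ, π.out L i = c • ((pauliOp b * V) *ᵥ L)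

/-- The probability that measurement of `N` sites executes `V`, on the input `L`. -/
def Rule.execProb (π : Rule m) (L : Qubits m ⊕ Qubits m → ℂ) (N : ℕ)
    (V : Matrix (Qubits m ⊕ Qubits m) (Qubits m ⊕ Qubits m) ℂ) : ℝ :=
  ∑ i : Fin N → Gen m, Set.indicator {i | π.Executes i V} (fun i => π.prob L i) i

/-- The outcomes `b` for which measurement of one site, in the basis rotated by
`exp(-i (θ/2) N_a)`, executes the gate `exp(-i θ N_a)` up to the byproduct `N_b`. -/
def successes (a : Gen m) (θ : ℝ) : Set (Gen m) :=
  {b | ∃ c : ℂ, c ≠ 0 ∧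
    krausOp (rotVec (expGate a (θ / 2)) b) = c • (gen b * expGate a θ)}

end MBQC

end SpAKLT

end

open SpAKLT

/-!
Every Pauli operator `P` satisfies `Δ Pᵀ = ± P Δ`, and the generators `N_a` are those with sign `-`,
that is, those in `𝔰𝔭`; they form a basis of it, and the Kraus map transports them to the on-site
basis. All counts reduce to the fact that the commutation signs with a fixed non-identity Pauli
operator sum to zero. Since each `N_b` is `i` times a symplectic unitary, outcomes in rotated bases
act on the edge spin by multiples of unitaries of one and the same norm, which makes them equally
likely. Moving the rotation `exp(-i (θ/2) N_a)` through `N_b` turns `g† N_b g` into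
`N_b exp(-i θ N_a)` or `N_b` according to the commutation sign.

The elementary gates generate a neighbourhood of the identity, by the inverse function theorem in
the coordinates given by the skew-Hermitian part. Every symplectic unitary is a product of rotations
by a phase on an eigenline and by the opposite phase on its quaternionic conjugate; these lie on
one-parameter groups, so they are powers of elements of that neighbourhood. A product of elementary
gates is executed by repeating each gate until it succeeds. The potential `2 ^ r - 1`, with `r` the
number of remaining gates, shrinks in the mean by a constant factor at every site, so by Markov's
inequality the rule succeeds with probability tending to one.
-/

namespace SpAKLT

variable {m : ℕ}

/-! ### Tensor powers of matrices -/

section PiKronecker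

variable {ι κ R : Type*} [Fintype ι]

/-- The tensor product `⨂ₖ f k` of a family of square matrices, acting on functions `ι → κ`; the
Pauli strings are the case of Pauli matrices. -/
def piKronecker [CommMonoid R] (f : ι → Matrix κ κ R) : Matrix (ι → κ) (ι → κ) R :=
  Matrix.of fun x y => ∏ k, f k (x k) (y k)

lemma piKronecker_mul [DecidableEq ι] [Fintype κ] [CommSemiring R] (f g : ι → Matrix κ κ R) :
    piKronecker f * piKronecker g = piKronecker fun k => f k * g k := by
  ext x z
  simp only [piKronecker, Matrix.mul_apply, Matrix.of_apply, ← Finset.prod_mul_distrib]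
  exact (Fintype.prod_sum fun k y => f k (x k) y * g k y (z k)).symm

lemma piKronecker_one [DecidableEq κ] [CommSemiring R] :
    piKronecker (fun _ : ι => (1 : Matrix κ κ R)) = 1 := by
  ext x y
  simp only [piKronecker, Matrix.of_apply, Matrix.one_apply, Finset.prod_boole, funext_iff,
    Finset.mem_univ, true_imp_iff]

lemma piKronecker_smul {S : Type*} [CommMonoid S] [CommMonoid R] [MulAction S R]
    [IsScalarTower S R R] [SMulCommClass S R R] (c : ι → S) (f : ι → Matrix κ κ R) :
    piKronecker (fun k => c k • f k) = (∏ k, c k) • piKronecker f := by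
  ext x y
  simp only [piKronecker, Matrix.of_apply, Matrix.smul_apply, Finset.prod_smul]

lemma piKronecker_transpose [CommMonoid R] (f : ι → Matrix κ κ R) :
    (piKronecker f)ᵀ = piKronecker fun k => (f k)ᵀ := rfl

lemma piKronecker_conjTranspose [CommSemiring R] [StarRing R] (f : ι → Matrix κ κ R) :
    (piKronecker f)ᴴ = piKronecker fun k => (f k)ᴴ := by
  ext x y
  simp only [piKronecker, Matrix.conjTranspose_apply, Matrix.of_apply, star_prod]

lemma trace_piKronecker [DecidableEq ι] [Fintype κ] [CommSemiring R] (f : ι → Matrix κ κ R) :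
    (piKronecker f).trace = ∏ k, (f k).trace :=
  (Fintype.prod_sum fun k y => f k y y).symm

end PiKronecker

section TensorLast

variable {l : Type}

lemma tensorLast_mul [Fintype l] (A B : Matrix l l ℂ) (σ τ : Matrix (Fin 2) (Fin 2) ℂ) :
    tensorLast A σ * tensorLast B τ = tensorLast (A * B) (σ * τ) := by
  simp [tensorLast, Matrix.fromBlocks_multiply, Matrix.mul_apply, Fin.sum_univ_two, smul_smul,
    add_smul, mul_comm]

lemma trace_tensorLast [Fintype l] (A : Matrix l l ℂ) (σ : Matrix (Fin 2) (Fin 2) ℂ) :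
    (tensorLast A σ).trace = A.trace * σ.trace := by
  simp [tensorLast, Matrix.trace, Finset.mul_sum, mul_comm, mul_add, Finset.sum_add_distrib]

lemma tensorLast_transpose (A : Matrix l l ℂ) (σ : Matrix (Fin 2) (Fin 2) ℂ) :
    (tensorLast A σ)ᵀ = tensorLast Aᵀ σᵀ := by
  simp [tensorLast, Matrix.fromBlocks_transpose]

lemma tensorLast_conjTranspose (A : Matrix l l ℂ) (σ : Matrix (Fin 2) (Fin 2) ℂ) :
    (tensorLast A σ)ᴴ = tensorLast Aᴴ σᴴ := by
  simp [tensorLast, Matrix.fromBlocks_conjTranspose]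

lemma tensorLast_smul_smul {S : Type*} [CommMonoid S] [MulAction S ℂ] [IsScalarTower S ℂ ℂ]
    [SMulCommClass S ℂ ℂ] (c d : S) (A : Matrix l l ℂ) (σ : Matrix (Fin 2) (Fin 2) ℂ) :
    tensorLast (c • A) (d • σ) = (c * d) • tensorLast A σ := by
  ext (i | i) (j | j) <;> simp [tensorLast, mul_smul_comm, smul_smul, mul_comm d c]

lemma tensorLast_one [DecidableEq l] : tensorLast (1 : Matrix l l ℂ) 1 = 1 := by
  simp [tensorLast]

lemma J_eq_tensorLast [DecidableEq l] : Matrix.J l ℂ = tensorLast 1 !![0, -1; 1, 0] := by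
  simp [tensorLast, Matrix.J]

end TensorLast

/-! ### Pauli matrices and their signs -/

/-- The sign in `σ_p σ_q = ± σ_q σ_p`. -/
def pauliCommSign (p q : Fin 4) : ℤˣ := if p = 0 ∨ q = 0 ∨ p = q then 1 else -1

/-- The sign in `σᵀ = ± σ`. -/
def pauliTransSign (p : Fin 4) : ℤˣ := if p = 2 then -1 else 1

/-- The sign in `Δ σᵀ = ± σ Δ`. -/
def pauliSympSign (p : Fin 4) : ℤˣ := if p = 0 then 1 else -1

lemma pauli_mul_comm (p q : Fin 4) :
    pauli p * pauli q = pauliCommSign p q • (pauli q * pauli p) := by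
  fin_cases p <;> fin_cases q <;> simp [pauli, pauliCommSign, Matrix.one_fin_two]

lemma pauli_transpose (p : Fin 4) : (pauli p)ᵀ = pauliTransSign p • pauli p := by
  fin_cases p <;> ext i j <;> fin_cases i <;> fin_cases j <;>
    simp [pauli, pauliTransSign, Matrix.one_fin_two]

lemma mul_pauli_transpose (p : Fin 4) : !![0, -1; 1, 0] * (pauli p)ᵀ =
    pauliSympSign p • (pauli p * !![0, -1; 1, 0]) := by
  fin_cases p <;> ext i j <;> fin_cases i <;> fin_cases j <;>
    simp [pauli, pauliSympSign, Matrix.one_fin_two, Matrix.mul_apply]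

lemma pauli_conjTranspose (p : Fin 4) : (pauli p)ᴴ = pauli p := by
  fin_cases p <;> ext i j <;> fin_cases i <;> fin_cases j <;>
    simp [pauli, Matrix.one_fin_two]

lemma pauli_mul_self (p : Fin 4) : pauli p * pauli p = 1 := by
  fin_cases p <;> simp [pauli, Matrix.one_fin_two]

lemma trace_pauli_mul_pauli (p q : Fin 4) :
    (pauli p * pauli q).trace = if p = q then 2 else 0 := by
  fin_cases p <;> fin_cases q <;> simp [pauli, Matrix.one_fin_two, Matrix.trace_fin_two] <;>
    norm_num

-- In the order `𝟙, X, Y, Z` of the labels, multiplication up to phases is bitwise addition.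
lemma exists_pauli_mul_eq_smul (p q : Fin 4) :
    ∃ c : ℂ, c ≠ 0 ∧ pauli p * pauli q = c • pauli (p ^^^ q) := by
  suffices h : ∃ c ∈ ({1, Complex.I, -Complex.I} : Set ℂ),
      pauli p * pauli q = c • pauli (p ^^^ q) by
    obtain ⟨c, rfl | rfl | rfl, h⟩ := h
    exacts [⟨1, one_ne_zero, h⟩, ⟨Complex.I, Complex.I_ne_zero, h⟩,
      ⟨-Complex.I, neg_ne_zero.mpr Complex.I_ne_zero, h⟩]
  fin_cases p <;> fin_cases q <;>
    simp [pauli, Matrix.one_fin_two]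

/-! ### Pauli strings -/

/-- The sign in `P Q = ± Q P` for Pauli strings. -/
def commSign (p q : Fin m → Fin 4) : ℤˣ := ∏ k, pauliCommSign (p k) (q k)

/-- The sign in `Pᵀ = ± P` for Pauli strings. -/
def transSign (p : Fin m → Fin 4) : ℤˣ := ∏ k, pauliTransSign (p k)

lemma pauliString_eq_piKronecker (p : Fin m → Fin 4) :
    pauliString p = piKronecker fun k => pauli (p k) := rfl

lemma pauliString_mul_comm (p q : Fin m → Fin 4) :
    pauliString p * pauliString q = commSign p q • (pauliString q * pauliString p) := by
  simp only [pauliString_eq_piKronecker, piKronecker_mul, commSign, ← piKronecker_smul,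
    ← pauli_mul_comm]

lemma pauliString_transpose (p : Fin m → Fin 4) :
    (pauliString p)ᵀ = transSign p • pauliString p := by
  simp only [pauliString_eq_piKronecker, piKronecker_transpose, pauli_transpose,
    piKronecker_smul, transSign]

lemma pauliString_conjTranspose (p : Fin m → Fin 4) : (pauliString p)ᴴ = pauliString p := by
  simp only [pauliString_eq_piKronecker, piKronecker_conjTranspose, pauli_conjTranspose]

lemma pauliString_zero : pauliString (0 : Fin m → Fin 4) = 1 := piKronecker_one

lemma pauliString_mul_self (p : Fin m → Fin 4) : pauliString p * pauliString p = 1 := by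
  simp only [pauliString_eq_piKronecker, piKronecker_mul, pauli_mul_self, piKronecker_one]

lemma trace_pauliString_mul_pauliString (p q : Fin m → Fin 4) :
    (pauliString p * pauliString q).trace = if p = q then 2 ^ m else 0 := by
  simp only [pauliString_eq_piKronecker, piKronecker_mul, trace_piKronecker, trace_pauli_mul_pauli]
  rcases eq_or_ne p q with rfl | h
  · simp
  · obtain ⟨k, hk⟩ := Function.ne_iff.mp h
    rw [if_neg h, Finset.prod_eq_zero (Finset.mem_univ k) (if_neg hk)]

lemma exists_pauliString_mul_eq_smul (p q : Fin m → Fin 4) :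
    ∃ c : ℂ, c ≠ 0 ∧ pauliString p * pauliString q = c • pauliString fun k => p k ^^^ q k := by
  choose c hc h using exists_pauli_mul_eq_smul
  refine ⟨∏ k, c (p k) (q k), Finset.prod_ne_zero_iff.mpr fun k _ => hc _ _, ?_⟩
  simp only [pauliString_eq_piKronecker, piKronecker_mul, h, piKronecker_smul]

section Sign

variable {V : Type*} [AddCommGroup V] [Module ℚ V]

lemma units_int_smul_eq_self_iff {x : V} (hx : x ≠ 0) (u : ℤˣ) : u • x = x ↔ u = 1 := by
  have := IsAddTorsionFree.of_module_rat V
  rcases Int.units_eq_one_or u with rfl | rfl <;> simp [hx, neg_eq_self]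

lemma units_int_smul_eq_neg_iff {x : V} (hx : x ≠ 0) (u : ℤˣ) : u • x = -x ↔ u = -1 := by
  rw [← neg_eq_iff_eq_neg, ← Units.neg_smul, units_int_smul_eq_self_iff hx, neg_eq_iff_eq_neg]

end Sign

lemma commute_pauliString_iff (p q : Fin m → Fin 4) :
    Commute (pauliString p) (pauliString q) ↔ commSign p q = 1 := by
  have hne : pauliString q * pauliString p ≠ 0 :=
    ((IsUnit.of_mul_eq_one _ (pauliString_mul_self q)).mul
      (.of_mul_eq_one _ (pauliString_mul_self p))).ne_zero
  rw [← units_int_smul_eq_self_iff hne, ← pauliString_mul_comm]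
  rfl

lemma mem_yStrings {p : Fin m → Fin 4} : p ∈ yStrings m ↔ transSign p = -1 := by
  have h : transSign p = (-1) ^ (Finset.univ.filter fun k => p k = 2).card := by
    simp [transSign, pauliTransSign, Finset.prod_ite]
  rw [h, neg_one_pow_eq_neg_one_iff_odd (by decide), yStrings, Finset.mem_filter_univ]

/-- A Pauli string that is diagonal in the computational basis. -/
def IsDiagString (p : Fin m → Fin 4) : Prop := ∀ k, p k = 0 ∨ p k = 3

instance : DecidablePred (IsDiagString (m := m)) := fun p =>
  inferInstanceAs (Decidable (∀ k, p k = 0 ∨ p k = 3))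

lemma isDiagString_zero : IsDiagString (0 : Fin m → Fin 4) := fun _ => Or.inl rfl

lemma not_isDiagString {p : Fin m → Fin 4} : ¬ IsDiagString p ↔ ∃ k, p k = 1 ∨ p k = 2 := by
  have h : ∀ x : Fin 4, ¬ (x = 0 ∨ x = 3) ↔ x = 1 ∨ x = 2 := by decide
  simp only [IsDiagString, not_forall, h]

lemma IsDiagString.transSign_eq_one {p : Fin m → Fin 4} (h : IsDiagString p) :
    transSign p = 1 :=
  Finset.prod_eq_one fun k _ => by rcases h k with h | h <;> simp [h, pauliTransSign]

lemma mem_xStrings {p : Fin m → Fin 4} :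
    p ∈ xStrings m ↔ transSign p = 1 ∧ ¬ IsDiagString p := by
  have h : transSign p = 1 ↔ p ∉ yStrings m := by
    rw [mem_yStrings]
    rw [← ne_eq, Int.units_ne_iff_eq_neg, neg_neg]
  rw [h, not_isDiagString]
  simp [xStrings, yStrings]

lemma mem_zStrings {p : Fin m → Fin 4} : p ∈ zStrings m ↔ IsDiagString p ∧ p ≠ 0 := by
  simp only [zStrings, Finset.mem_filter_univ]
  refine and_congr_right fun h => ?_
  rw [Function.ne_iff]
  refine exists_congr fun k => ?_
  rcases h k with h | h <;> simp [h]

/-! ### Pauli operators on `m + 1` qubits -/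

/-- The sign in `P Q = ± Q P` for Pauli operators on `m + 1` qubits. -/
def opCommSign (a b : (Fin m → Fin 4) × Fin 4) : ℤˣ :=
  commSign a.1 b.1 * pauliCommSign a.2 b.2

/-- The sign in `Δ Pᵀ = ± P Δ` for Pauli operators on `m + 1` qubits. -/
def sympSign (a : (Fin m → Fin 4) × Fin 4) : ℤˣ := transSign a.1 * pauliSympSign a.2

/-- The label of the product of two Pauli operators. -/
def mulLabel (a b : (Fin m → Fin 4) × Fin 4) : (Fin m → Fin 4) × Fin 4 :=
  (fun k => a.1 k ^^^ b.1 k, a.2 ^^^ b.2)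

lemma pauliOp_mul_comm (a b : (Fin m → Fin 4) × Fin 4) :
    pauliOp a * pauliOp b = opCommSign a b • (pauliOp b * pauliOp a) := by
  simp only [pauliOp, tensorLast_mul]
  rw [opCommSign, ← tensorLast_smul_smul, ← pauliString_mul_comm, ← pauli_mul_comm]

lemma pauliOp_conjTranspose (a : (Fin m → Fin 4) × Fin 4) : (pauliOp a)ᴴ = pauliOp a := by
  rw [pauliOp, tensorLast_conjTranspose, pauliString_conjTranspose, pauli_conjTranspose]

lemma pauliOp_zero : pauliOp (0 : (Fin m → Fin 4) × Fin 4) = 1 := by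
  rw [pauliOp, Prod.fst_zero, pauliString_zero]
  exact tensorLast_one

lemma pauliOp_mul_self (a : (Fin m → Fin 4) × Fin 4) : pauliOp a * pauliOp a = 1 := by
  rw [pauliOp, tensorLast_mul, pauliString_mul_self, pauli_mul_self, tensorLast_one]

lemma exists_pauliOp_mul_eq_smul (a b : (Fin m → Fin 4) × Fin 4) :
    ∃ c : ℂ, c ≠ 0 ∧ pauliOp a * pauliOp b = c • pauliOp (mulLabel a b) := by
  obtain ⟨c, hc, h⟩ := exists_pauliString_mul_eq_smul a.1 b.1
  obtain ⟨d, hd, h'⟩ := exists_pauli_mul_eq_smul a.2 b.2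
  exact ⟨c * d, mul_ne_zero hc hd, by
    rw [pauliOp, pauliOp, tensorLast_mul, h, h', tensorLast_smul_smul, pauliOp, mulLabel]⟩

lemma trace_pauliOp_mul_pauliOp (a b : (Fin m → Fin 4) × Fin 4) :
    (pauliOp a * pauliOp b).trace = if a = b then 2 ^ (m + 1) else 0 := by
  rw [pauliOp, pauliOp, tensorLast_mul, trace_tensorLast, trace_pauliString_mul_pauliString,
    trace_pauli_mul_pauli]
  by_cases h1 : a.1 = b.1 <;> by_cases h2 : a.2 = b.2 <;> simp [h1, h2, Prod.ext_iff, pow_succ]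

lemma J_mul_pauliOp_transpose (a : (Fin m → Fin 4) × Fin 4) :
    Matrix.J (Qubits m) ℂ * (pauliOp a)ᵀ =
      sympSign a • (pauliOp a * Matrix.J (Qubits m) ℂ) := by
  rw [pauliOp, J_eq_tensorLast, tensorLast_transpose, tensorLast_mul, tensorLast_mul,
    mul_pauli_transpose, pauliString_transpose, sympSign, ← tensorLast_smul_smul, one_mul, mul_one]

lemma mem_genLabels {a : (Fin m → Fin 4) × Fin 4} : a ∈ genLabels m ↔ sympSign a = -1 := by
  obtain ⟨p, k⟩ := a
  have symmetric_iff : p ∈ xStrings m ∪ zStrings m ∪ {fun _ => 0} ↔ transSign p = 1 := by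
    have h0 : p = (fun _ => 0) → IsDiagString p := fun h => h ▸ isDiagString_zero
    have hd : IsDiagString p → transSign p = 1 := IsDiagString.transSign_eq_one
    simp only [Finset.mem_union, mem_xStrings, mem_zStrings, Finset.mem_singleton]
    change (_ ∨ _ ∧ p ≠ fun _ => 0) ∨ _ ↔ _
    tauto
  have hk : k ∈ ({1, 2, 3} : Finset (Fin 4)) ↔ k ≠ 0 := by revert k; decide
  rw [genLabels, Finset.mem_union, Finset.mem_product, Finset.mem_product]
  simp only [symmetric_iff, hk, mem_yStrings, Finset.mem_singleton, sympSign, pauliSympSign]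
  rcases Int.units_eq_one_or (transSign p) with h | h <;> by_cases hk0 : k = 0 <;>
    simp [h, hk0]

/-! ### Counting Pauli strings and generators by their signs -/

section UnitsCount

variable {α : Type*}

-- The indicator function of `u = ε` is `(1 + ε u) / 2`.
lemma two_mul_ite_units_eq (u ε : ℤˣ) : 2 * (if u = ε then 1 else 0 : ℤ) = 1 + ε * u := by
  revert u ε
  decide

lemma two_mul_card_filter_units_eq (s : Finset α) (f : α → ℤˣ) (ε : ℤˣ) :
    2 * ((s.filter fun x => f x = ε).card : ℤ) = s.card + ε * ∑ x ∈ s, (f x : ℤ) := by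
  rw [Finset.natCast_card_filter, Finset.mul_sum]
  simp only [two_mul_ite_units_eq, Finset.sum_add_distrib, Finset.sum_const, Finset.mul_sum,
    nsmul_eq_mul, mul_one]

lemma four_mul_card_filter_units_eq (s : Finset α) (f g : α → ℤˣ) (ε δ : ℤˣ) :
    4 * ((s.filter fun x => f x = ε ∧ g x = δ).card : ℤ) =
      s.card + ε * ∑ x ∈ s, (f x : ℤ) + δ * ∑ x ∈ s, (g x : ℤ) +
        ε * δ * ∑ x ∈ s, (f x * g x : ℤ) := by
  have indicator (x : α) : 4 * (if f x = ε ∧ g x = δ then 1 else 0 : ℤ) =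
      1 + ε * f x + δ * g x + ε * δ * (f x * g x) := by
    generalize f x = u, g x = v
    revert ε δ u v
    decide
  rw [Finset.natCast_card_filter, Finset.mul_sum]
  simp only [indicator, Finset.sum_add_distrib, Finset.sum_const, Finset.mul_sum, nsmul_eq_mul,
    mul_one]

end UnitsCount

lemma sum_pauliCommSign {p : Fin 4} (hp : p ≠ 0) : ∑ q, (pauliCommSign p q : ℤ) = 0 := by
  revert p
  decide

lemma sum_transSign : ∑ q : Fin m → Fin 4, (transSign q : ℤ) = 2 ^ m := by
  have h : ∑ q, (pauliTransSign q : ℤ) = 2 := by decide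
  simp only [transSign, Units.coe_prod]
  rw [← Fintype.prod_sum fun _ q => (pauliTransSign q : ℤ), h, Finset.prod_const,
    Finset.card_univ, Fintype.card_fin]

lemma sum_commSign {p : Fin m → Fin 4} (hp : p ≠ 0) : ∑ q, (commSign p q : ℤ) = 0 := by
  obtain ⟨k, hk⟩ := Function.ne_iff.mp hp
  simp only [commSign, Units.coe_prod]
  rw [← Fintype.prod_sum fun k q => (pauliCommSign (p k) q : ℤ)]
  exact Finset.prod_eq_zero (Finset.mem_univ k) (sum_pauliCommSign hk)

lemma sum_transSign_mul_commSign (p : Fin m → Fin 4) :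
    ∑ q, (transSign q * commSign p q : ℤ) = 2 ^ m * transSign p := by
  have h (p : Fin 4) : ∑ q, (pauliTransSign q * pauliCommSign p q : ℤ) = 2 * pauliTransSign p := by
    revert p
    decide
  simp only [transSign, commSign, Units.coe_prod, ← Finset.prod_mul_distrib]
  rw [← Fintype.prod_sum fun k q => (pauliTransSign q * pauliCommSign (p k) q : ℤ)]
  simp [h, Finset.prod_mul_distrib]

lemma sum_commSign_isDiagString (p : Fin m → Fin 4) :
    ∑ q with IsDiagString q, (commSign p q : ℤ) = if IsDiagString p then 2 ^ m else 0 := by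
  have hdiag : Finset.univ.filter (IsDiagString (m := m)) = Fintype.piFinset fun _ => {0, 3} := by
    ext q
    simp [IsDiagString]
  have h (p : Fin 4) : ∑ q ∈ {0, 3}, (pauliCommSign p q : ℤ) = if p = 0 ∨ p = 3 then 2 else 0 := by
    revert p
    decide
  simp only [hdiag, commSign, Units.coe_prod]
  rw [← Finset.prod_univ_sum (fun _ => {0, 3}) fun k q => (pauliCommSign (p k) q : ℤ)]
  simp only [h, Finset.prod_ite_zero, Finset.mem_univ, true_imp_iff, Finset.prod_const,
    Finset.card_univ, Fintype.card_fin]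
  rfl

lemma commSign_zero_left (q : Fin m → Fin 4) : commSign 0 q = 1 :=
  Finset.prod_eq_one fun _ _ => if_pos (Or.inl rfl)

lemma commSign_zero_right (p : Fin m → Fin 4) : commSign p 0 = 1 :=
  Finset.prod_eq_one fun _ _ => if_pos (Or.inr (Or.inl rfl))

lemma card_isDiagString : (Finset.univ.filter (IsDiagString (m := m))).card = 2 ^ m := by
  have h := sum_commSign_isDiagString (0 : Fin m → Fin 4)
  rw [if_pos isDiagString_zero] at h
  simp only [commSign_zero_left, Units.val_one, Finset.sum_const, nsmul_eq_mul, mul_one] at h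
  exact_mod_cast h

lemma card_pauliStrings : Fintype.card (Fin m → Fin 4) = (2 ^ m) ^ 2 := by
  rw [Fintype.card_fun, Fintype.card_fin, Fintype.card_fin, ← pow_mul', pow_mul]
  norm_num

section Commuting

variable (p : Fin m → Fin 4)

lemma four_mul_card_transSign_eq_and_commSign_eq_one {p : Fin m → Fin 4} (hp : p ≠ 0) (ε : ℤˣ) :
    4 * ((Finset.univ.filter fun q => transSign q = ε ∧ commSign p q = 1).card : ℤ) =
      (2 ^ m) ^ 2 + ε * 2 ^ m * (1 + transSign p) := by
  rw [four_mul_card_filter_units_eq, sum_transSign, sum_commSign hp, sum_transSign_mul_commSign,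
    Finset.card_univ, card_pauliStrings]
  push_cast
  ring

lemma two_mul_card_isDiagString_and_commSign_eq_one :
    2 * ((Finset.univ.filter fun q => IsDiagString q ∧ commSign p q = 1).card : ℤ) =
      2 ^ m + if IsDiagString p then 2 ^ m else 0 := by
  rw [← Finset.filter_filter, two_mul_card_filter_units_eq, sum_commSign_isDiagString,
    card_isDiagString]
  simp

lemma ncard_commute_yStrings :
    {q | q ∈ yStrings m ∧ Commute (pauliString p) (pauliString q)}.ncard =
      (Finset.univ.filter fun q => transSign q = -1 ∧ commSign p q = 1).card := by
  simp only [mem_yStrings, commute_pauliString_iff, ← Set.ncard_coe_finset, Finset.coe_filter_univ]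

lemma ncard_commute_xStrings_add :
    {q | q ∈ xStrings m ∧ Commute (pauliString p) (pauliString q)}.ncard +
        (Finset.univ.filter fun q => IsDiagString q ∧ commSign p q = 1).card =
      (Finset.univ.filter fun q => transSign q = 1 ∧ commSign p q = 1).card := by
  simp only [mem_xStrings, commute_pauliString_iff, ← Set.ncard_coe_finset, Finset.coe_filter_univ]
  rw [← Set.ncard_union_eq]
  · congr 1
    ext q
    by_cases h : IsDiagString q <;> simp [h, IsDiagString.transSign_eq_one]
  · exact Set.disjoint_left.mpr fun q hq hq' => hq.1.2 hq'.1

lemma ncard_commute_zStrings_add_one :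
    {q | q ∈ zStrings m ∧ Commute (pauliString p) (pauliString q)}.ncard + 1 =
      (Finset.univ.filter fun q => IsDiagString q ∧ commSign p q = 1).card := by
  simp only [mem_zStrings, commute_pauliString_iff, ← Set.ncard_coe_finset, Finset.coe_filter_univ]
  rw [← Set.ncard_insert_of_notMem (a := 0) fun h => h.1.2 rfl]
  congr 1
  ext q
  rcases eq_or_ne q 0 with rfl | h <;>
    simp_all [isDiagString_zero, commSign_zero_right]

end Commuting

theorem ncard_commute_of_mem_xStrings {p : Fin m → Fin 4} (hp : p ∈ xStrings m) :
    4 * {q | q ∈ xStrings m ∧ Commute (pauliString p) (pauliString q)}.ncard = (2 ^ m) ^ 2 ∧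
    4 * {q | q ∈ yStrings m ∧ Commute (pauliString p) (pauliString q)}.ncard + 2 * 2 ^ m =
      (2 ^ m) ^ 2 ∧
    2 * {q | q ∈ zStrings m ∧ Commute (pauliString p) (pauliString q)}.ncard + 2 = 2 ^ m := by
  obtain ⟨hs, hd⟩ := mem_xStrings.mp hp
  have h0 : p ≠ 0 := fun h => hd (h ▸ isDiagString_zero)
  have hplus := four_mul_card_transSign_eq_and_commSign_eq_one h0 1
  have hminus := four_mul_card_transSign_eq_and_commSign_eq_one h0 (-1)
  have hdiag := two_mul_card_isDiagString_and_commSign_eq_one p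
  rw [← ncard_commute_xStrings_add, ← ncard_commute_zStrings_add_one] at hplus
  rw [← ncard_commute_zStrings_add_one, if_neg hd] at hdiag
  rw [← ncard_commute_yStrings] at hminus
  simp only [hs] at hplus hminus
  zify
  push_cast at *
  exact ⟨by linarith, by linarith, by linarith⟩

theorem ncard_commute_of_mem_yStrings {p : Fin m → Fin 4} (hp : p ∈ yStrings m) :
    4 * {q | q ∈ yStrings m ∧ Commute (pauliString p) (pauliString q)}.ncard = (2 ^ m) ^ 2 ∧
    4 * {q | q ∈ xStrings m ∧ Commute (pauliString p) (pauliString q)}.ncard + 2 * 2 ^ m =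
      (2 ^ m) ^ 2 ∧
    2 * {q | q ∈ zStrings m ∧ Commute (pauliString p) (pauliString q)}.ncard + 2 = 2 ^ m := by
  have hs := mem_yStrings.mp hp
  have hd : ¬ IsDiagString p := fun h => by simp [h.transSign_eq_one] at hs
  have h0 : p ≠ 0 := fun h => hd (h ▸ isDiagString_zero)
  have hplus := four_mul_card_transSign_eq_and_commSign_eq_one h0 1
  have hminus := four_mul_card_transSign_eq_and_commSign_eq_one h0 (-1)
  have hdiag := two_mul_card_isDiagString_and_commSign_eq_one p
  rw [← ncard_commute_xStrings_add, ← ncard_commute_zStrings_add_one] at hplus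
  rw [← ncard_commute_zStrings_add_one, if_neg hd] at hdiag
  rw [← ncard_commute_yStrings] at hminus
  simp only [hs] at hplus hminus
  zify
  push_cast at *
  exact ⟨by linarith, by linarith, by linarith⟩

theorem ncard_commute_of_mem_zStrings {p : Fin m → Fin 4} (hp : p ∈ zStrings m) :
    4 * {q | q ∈ xStrings m ∧ Commute (pauliString p) (pauliString q)}.ncard + 2 * 2 ^ m =
      (2 ^ m) ^ 2 ∧
    4 * {q | q ∈ yStrings m ∧ Commute (pauliString p) (pauliString q)}.ncard + 2 * 2 ^ m =
      (2 ^ m) ^ 2 := by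
  obtain ⟨hd, h0⟩ := mem_zStrings.mp hp
  have hplus := four_mul_card_transSign_eq_and_commSign_eq_one h0 1
  have hminus := four_mul_card_transSign_eq_and_commSign_eq_one h0 (-1)
  have hdiag := two_mul_card_isDiagString_and_commSign_eq_one p
  rw [← ncard_commute_xStrings_add] at hplus
  rw [if_pos hd] at hdiag
  rw [← ncard_commute_yStrings] at hminus
  simp only [hd.transSign_eq_one] at hplus hminus
  zify
  push_cast at *
  exact ⟨by linarith, by linarith⟩

lemma sympSign_gen (a : Gen m) : sympSign a.1 = -1 := mem_genLabels.mp a.2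

lemma Gen.label_ne_zero (a : Gen m) : a.1 ≠ 0 := fun h => by
  have := sympSign_gen a
  simp [h, sympSign, transSign, pauliTransSign, pauliSympSign] at this

lemma sum_sympSign : ∑ a : (Fin m → Fin 4) × Fin 4, (sympSign a : ℤ) = -2 * 2 ^ m := by
  have h : ∑ p, (pauliSympSign p : ℤ) = -2 := by decide
  simp only [Fintype.sum_prod_type, sympSign, Units.val_mul, ← Finset.mul_sum, h,
    ← Finset.sum_mul, sum_transSign]
  ring

lemma sum_opCommSign {a : (Fin m → Fin 4) × Fin 4} (ha : a ≠ 0) :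
    ∑ b, (opCommSign a b : ℤ) = 0 := by
  simp only [Fintype.sum_prod_type, opCommSign, Units.val_mul, ← Finset.mul_sum, ← Finset.sum_mul]
  rcases eq_or_ne a.1 0 with h1 | h1
  · have h2 : a.2 ≠ 0 := fun h2 => ha (Prod.ext h1 h2)
    rw [sum_pauliCommSign h2, mul_zero]
  · rw [sum_commSign h1, zero_mul]

lemma sum_sympSign_mul_opCommSign (a : (Fin m → Fin 4) × Fin 4) :
    ∑ b, (sympSign b * opCommSign a b : ℤ) = -2 * 2 ^ m * sympSign a := by
  have h (p : Fin 4) : ∑ q, (pauliSympSign q * pauliCommSign p q : ℤ) = -2 * pauliSympSign p := by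
    revert p
    decide
  simp only [Fintype.sum_prod_type, sympSign, opCommSign, Units.val_mul, mul_mul_mul_comm]
  rw [← Fintype.sum_mul_sum, h, sum_transSign_mul_commSign]
  ring

lemma card_pauliOps : Fintype.card ((Fin m → Fin 4) × Fin 4) = 4 * (2 ^ m) ^ 2 := by
  rw [Fintype.card_prod, card_pauliStrings, Fintype.card_fin, mul_comm]

lemma genLabels_eq_filter :
    genLabels m = Finset.univ.filter fun a => sympSign a = -1 := by
  ext a
  rw [mem_genLabels, Finset.mem_filter_univ]

theorem card_gen : Fintype.card (Gen m) = 2 ^ m * (2 * 2 ^ m + 1) := by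
  have h := two_mul_card_filter_units_eq Finset.univ (sympSign (m := m)) (-1)
  rw [← genLabels_eq_filter, sum_sympSign, Finset.card_univ, card_pauliOps] at h
  rw [Fintype.card_coe]
  zify
  push_cast at h
  linarith

theorem card_anticommuting_gen (a : Gen m) :
    (Finset.univ.filter fun b : Gen m => opCommSign a.1 b.1 = -1).card =
      2 ^ m * (2 ^ m + 1) := by
  have h := four_mul_card_filter_units_eq Finset.univ sympSign (opCommSign a.1) (-1) (-1)
  rw [← Finset.filter_filter, ← genLabels_eq_filter, sum_sympSign,
    sum_opCommSign a.label_ne_zero, sum_sympSign_mul_opCommSign, sympSign_gen, Finset.card_univ,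
    card_pauliOps] at h
  rw [Finset.card_filter, Finset.sum_coe_sort (genLabels m) fun b =>
    if opCommSign a.1 b = -1 then 1 else 0, ← Finset.card_filter]
  zify
  push_cast at h
  linarith

/-! ### Expansion of matrices in Pauli strings -/

lemma eq_sum_trace_smul {ι κ K : Type*} [Fintype ι] [Fintype κ] [DecidableEq κ] [Field K]
    {P : κ → Matrix ι ι K} {d : K} (hd : d ≠ 0)
    (hP : ∀ a b, (P a * P b).trace = if a = b then d else 0)
    (hcard : Fintype.card κ = Fintype.card ι * Fintype.card ι) (A : Matrix ι ι K) :
    A = ∑ a, ((P a * A).trace / d) • P a := by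
  have trace_mul_sum (c : κ → K) (a : κ) : (P a * ∑ b, c b • P b).trace = c a * d := by
    simp [Finset.mul_sum, Matrix.trace_sum, Matrix.trace_smul, hP]
  have independent : LinearIndependent K P := by
    refine Fintype.linearIndependent_iff.mpr fun c hc a => ?_
    have h := trace_mul_sum c a
    rw [hc, mul_zero, Matrix.trace_zero] at h
    exact (mul_eq_zero.mp h.symm).resolve_right hd
  have span_eq_top : Submodule.span K (Set.range P) = ⊤ :=
    independent.span_eq_top_of_card_eq_finrank' <| by
      rw [hcard, Module.finrank_matrix, Module.finrank_self, mul_one]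
  obtain ⟨c, rfl⟩ := (Submodule.mem_span_range_iff_exists_fun K).mp
    (span_eq_top ▸ Submodule.mem_top : A ∈ Submodule.span K (Set.range P))
  simp only [trace_mul_sum, mul_div_cancel_right₀ _ hd]

lemma eq_sum_pauliString (A : Matrix (Qubits m) (Qubits m) ℂ) :
    A = ∑ p, ((pauliString p * A).trace / 2 ^ m) • pauliString p :=
  eq_sum_trace_smul (by simp) trace_pauliString_mul_pauliString
    (by rw [card_pauliStrings, sq]; simp) A

lemma card_virtual : Fintype.card (Qubits m ⊕ Qubits m) = 2 * 2 ^ m := by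
  simp [two_mul]

lemma eq_sum_pauliOp (A : Matrix (Qubits m ⊕ Qubits m) (Qubits m ⊕ Qubits m) ℂ) :
    A = ∑ a, ((pauliOp a * A).trace / 2 ^ (m + 1)) • pauliOp a :=
  eq_sum_trace_smul (by simp) trace_pauliOp_mul_pauliOp
    (by rw [card_pauliOps, card_virtual]; ring) A

/-! ### Real spans of Pauli strings and of Gell-Mann matrices -/

section RealSubspaces

variable (ι : Type*)

/-- Real symmetric matrices with zero diagonal, the common span of the Pauli strings of type `𝒳`
and of the matrices `X_{ij}`. Reality is encoded as being hermitian and symmetric. -/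
def realSymmOffDiag : Submodule ℝ (Matrix ι ι ℂ) where
  carrier := {A | Aᴴ = A ∧ Aᵀ = A ∧ ∀ x, A x x = 0}
  add_mem' := by
    rintro A B ⟨h1, h2, h3⟩ ⟨h1', h2', h3'⟩
    exact ⟨by rw [Matrix.conjTranspose_add, h1, h1'], by rw [Matrix.transpose_add, h2, h2'],
      fun x => by rw [Matrix.add_apply, h3, h3', add_zero]⟩
  zero_mem' := by simp
  smul_mem' := by
    rintro c A ⟨h1, h2, h3⟩
    exact ⟨by rw [Matrix.conjTranspose_smul, h1, star_trivial], by rw [Matrix.transpose_smul, h2],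
      fun x => by rw [Matrix.smul_apply, h3, smul_zero]⟩

/-- Imaginary antisymmetric matrices, the common span of the Pauli strings of type `𝒴` and of the
matrices `Y_{ij}`. -/
def imagAntisymm : Submodule ℝ (Matrix ι ι ℂ) where
  carrier := {A | Aᴴ = A ∧ Aᵀ = -A}
  add_mem' := by
    rintro A B ⟨h1, h2⟩ ⟨h1', h2'⟩
    exact ⟨by rw [Matrix.conjTranspose_add, h1, h1'],
      by rw [Matrix.transpose_add, h2, h2', neg_add]⟩
  zero_mem' := by simp
  smul_mem' := by
    rintro c A ⟨h1, h2⟩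
    exact ⟨by rw [Matrix.conjTranspose_smul, h1, star_trivial],
      by rw [Matrix.transpose_smul, h2, smul_neg]⟩

/-- Real diagonal matrices of trace zero, the common span of the Pauli strings of type `𝒵` and of
the matrices `Z_j`. -/
def realDiagTraceless [Fintype ι] : Submodule ℝ (Matrix ι ι ℂ) where
  carrier := {A | Aᴴ = A ∧ A.IsDiag ∧ A.trace = 0}
  add_mem' := by
    rintro A B ⟨h1, h2, h3⟩ ⟨h1', h2', h3'⟩
    exact ⟨by rw [Matrix.conjTranspose_add, h1, h1'], h2.add h2',
      by rw [Matrix.trace_add, h3, h3', add_zero]⟩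
  zero_mem' := by simp
  smul_mem' := by
    rintro c A ⟨h1, h2, h3⟩
    exact ⟨by rw [Matrix.conjTranspose_smul, h1, star_trivial], h2.smul c,
      by rw [Matrix.trace_smul, h3, smul_zero]⟩

end RealSubspaces

section TraceMulEqZero

variable {ι R : Type*} [Fintype ι] {A B : Matrix ι ι R}

lemma trace_mul_eq_zero_of_mul_transpose [DecidableEq ι] [CommRing R] [IsAddTorsionFree R]
    {J K : Matrix ι ι R} (hKJ : K * J = 1) (hA : J * Aᵀ = A * J) (hB : J * Bᵀ = -(B * J)) :
    (A * B).trace = 0 := by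
  refine self_eq_neg.mp ?_
  calc (A * B).trace = (K * (J * Bᵀ) * Aᵀ).trace := by
        rw [← Matrix.mul_assoc K, hKJ, Matrix.one_mul, ← Matrix.transpose_mul,
          Matrix.trace_transpose]
    _ = -(K * (B * (J * Aᵀ))).trace := by
        rw [hB, Matrix.mul_neg, Matrix.neg_mul, Matrix.trace_neg, Matrix.mul_assoc K,
          Matrix.mul_assoc B]
    _ = -(A * B).trace := by
        rw [hA, Matrix.trace_mul_comm K, Matrix.mul_assoc B, Matrix.mul_assoc A,
          mul_eq_one_comm.mp hKJ, Matrix.mul_one, Matrix.trace_mul_comm]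

lemma trace_mul_eq_zero_of_transpose_eq_neg [CommRing R] [IsAddTorsionFree R] (hA : Aᵀ = A)
    (hB : Bᵀ = -B) : (A * B).trace = 0 := by
  classical
  exact trace_mul_eq_zero_of_mul_transpose (J := 1) (K := 1) (one_mul 1) (by simp [hA])
    (by simp [hB])

lemma trace_mul_eq_zero_of_isDiag [NonUnitalNonAssocSemiring R] (hA : A.IsDiag)
    (hB : ∀ x, B x x = 0) : (A * B).trace = 0 := by
  refine Finset.sum_eq_zero fun x _ => Finset.sum_eq_zero fun y _ => ?_
  rcases eq_or_ne x y with rfl | h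
  · simp [hB]
  · simp [hA h]

end TraceMulEqZero

lemma mem_span_pauliString {S : Set (Fin m → Fin 4)} {A : Matrix (Qubits m) (Qubits m) ℂ}
    (hA : Aᴴ = A) (hS : ∀ p ∉ S, (pauliString p * A).trace = 0) :
    A ∈ Submodule.span ℝ (pauliString '' S) := by
  rw [eq_sum_pauliString A]
  refine Submodule.sum_mem _ fun p _ => ?_
  by_cases hp : p ∈ S
  · have hreal : starRingEnd ℂ (pauliString p * A).trace = (pauliString p * A).trace := by
      rw [starRingEnd_apply, ← Matrix.trace_conjTranspose, Matrix.conjTranspose_mul, hA,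
        pauliString_conjTranspose, Matrix.trace_mul_comm]
    obtain ⟨r, hr⟩ := Complex.conj_eq_iff_real.mp hreal
    have hsmul : ((pauliString p * A).trace / 2 ^ m) • pauliString p =
        (r / 2 ^ m : ℝ) • pauliString p := by
      rw [hr, ← Complex.coe_smul]
      push_cast
      rfl
    rw [hsmul]
    exact Submodule.smul_mem _ _ (Submodule.subset_span ⟨p, hp, rfl⟩)
  · rw [hS p hp, zero_div, zero_smul]
    exact Submodule.zero_mem _

lemma IsDiagString.isDiag_pauliString {p : Fin m → Fin 4} (hp : IsDiagString p) :
    (pauliString p).IsDiag := by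
  have entry (k : Fin 4) (hk : k = 0 ∨ k = 3) : (pauli k).IsDiag := by
    rcases hk with rfl | rfl <;> intro i j <;> fin_cases i <;> fin_cases j <;> simp [pauli]
  intro x y hxy
  obtain ⟨k, hk⟩ := Function.ne_iff.mp hxy
  exact Finset.prod_eq_zero (Finset.mem_univ k) (entry _ (hp k) hk)

lemma pauliString_apply_self {p : Fin m → Fin 4} (hp : ¬ IsDiagString p) (x : Qubits m) :
    pauliString p x x = 0 := by
  have entry (k : Fin 4) (hk : k = 1 ∨ k = 2) (i : Fin 2) : pauli k i i = 0 := by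
    rcases hk with rfl | rfl <;> fin_cases i <;> simp [pauli]
  obtain ⟨k, hk⟩ := not_isDiagString.mp hp
  exact Finset.prod_eq_zero (Finset.mem_univ k) (entry _ hk _)

lemma trace_pauliString {p : Fin m → Fin 4} (hp : p ≠ 0) : (pauliString p).trace = 0 := by
  have h := trace_pauliString_mul_pauliString 0 p
  rwa [pauliString_zero, one_mul, if_neg hp.symm] at h

lemma span_xStrings : Submodule.span ℝ (pauliString '' (xStrings m : Set (Fin m → Fin 4))) =
    realSymmOffDiag (Qubits m) := by
  apply le_antisymm
  · rw [Submodule.span_le]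
    rintro _ ⟨p, hp, rfl⟩
    obtain ⟨hs, hd⟩ := mem_xStrings.mp hp
    exact ⟨pauliString_conjTranspose p, by rw [pauliString_transpose, hs, one_smul],
      pauliString_apply_self hd⟩
  · rintro A ⟨hermitian, symmetric, hdiag⟩
    refine mem_span_pauliString hermitian fun p hp => ?_
    by_cases hd : IsDiagString p
    · exact trace_mul_eq_zero_of_isDiag hd.isDiag_pauliString hdiag
    · have hs : transSign p = -1 :=
        Int.units_ne_iff_eq_neg.mp fun hs => hp (mem_xStrings.mpr ⟨hs, hd⟩)
      rw [Matrix.trace_mul_comm]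
      exact trace_mul_eq_zero_of_transpose_eq_neg symmetric (by simp [pauliString_transpose, hs])

lemma span_yStrings : Submodule.span ℝ (pauliString '' (yStrings m : Set (Fin m → Fin 4))) =
    imagAntisymm (Qubits m) := by
  apply le_antisymm
  · rw [Submodule.span_le]
    rintro _ ⟨p, hp, rfl⟩
    exact ⟨pauliString_conjTranspose p, by simp [pauliString_transpose, mem_yStrings.mp hp]⟩
  · rintro A ⟨hermitian, antisymmetric⟩
    refine mem_span_pauliString hermitian fun p hp => ?_
    have hs : transSign p = 1 := by
      rw [← neg_neg 1, ← Int.units_ne_iff_eq_neg]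
      exact fun hs => hp (mem_yStrings.mpr hs)
    exact trace_mul_eq_zero_of_transpose_eq_neg (by simp [pauliString_transpose, hs]) antisymmetric

lemma span_zStrings : Submodule.span ℝ (pauliString '' (zStrings m : Set (Fin m → Fin 4))) =
    realDiagTraceless (Qubits m) := by
  apply le_antisymm
  · rw [Submodule.span_le]
    rintro _ ⟨p, hp, rfl⟩
    obtain ⟨hd, h0⟩ := mem_zStrings.mp hp
    exact ⟨pauliString_conjTranspose p, hd.isDiag_pauliString, trace_pauliString h0⟩
  · rintro A ⟨hermitian, diagonal, traceless⟩
    refine mem_span_pauliString hermitian fun p hp => ?_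
    by_cases hd : IsDiagString p
    · have h0 : p = 0 := by_contra fun h0 => hp (mem_zStrings.mpr ⟨hd, h0⟩)
      rw [h0, pauliString_zero, one_mul, traceless]
    · rw [Matrix.trace_mul_comm]
      exact trace_mul_eq_zero_of_isDiag diagonal (pauliString_apply_self hd)

section GellMann

variable {n : ℕ}

lemma gellMannX_comm (i j : Fin n) : gellMannX i j = gellMannX j i := by
  rw [gellMannX, gellMannX, add_comm]

lemma gellMannY_swap (i j : Fin n) : gellMannY i j = -gellMannY j i := by
  rw [gellMannY, gellMannY, ← smul_neg, neg_sub]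

lemma sum_smul_gellMannX (c : Fin n → Fin n → ℝ) :
    ∑ i, ∑ j, c i j • gellMannX i j = Matrix.of fun i j => (((c i j + c j i) / 2 : ℝ) : ℂ) := by
  ext a b
  simp [gellMannX, Matrix.sum_apply, Matrix.single_apply, Finset.sum_add_distrib,
    ite_and, -one_div]
  ring

lemma sum_smul_gellMannY (c : Fin n → Fin n → ℝ) :
    ∑ i, ∑ j, c i j • gellMannY i j =
      Matrix.of fun i j => (((c j i - c i j) / 2 : ℝ) : ℂ) * Complex.I := by
  ext a b
  simp [gellMannY, Matrix.sum_apply, Matrix.single_apply, Finset.sum_sub_distrib, mul_sub,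
    ite_and, -one_div]
  ring

lemma span_gellMannX : Submodule.span ℝ {A | ∃ i j : Fin n, i < j ∧ A = gellMannX i j} =
    realSymmOffDiag (Fin n) := by
  apply le_antisymm
  · rw [Submodule.span_le]
    rintro _ ⟨i, j, hij, rfl⟩
    refine ⟨?_, ?_, fun x => ?_⟩
    · simp [gellMannX, Matrix.conjTranspose_single, add_comm]
    · simp [gellMannX, Matrix.transpose_single, add_comm]
    · have hx : ¬ (i = x ∧ j = x) := fun h => hij.ne (h.1.trans h.2.symm)
      simp [gellMannX, hx, and_comm]
  · rintro A ⟨hermitian, symmetric, hdiag⟩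
    have expand : A = ∑ i, ∑ j, (A i j).re • gellMannX i j := by
      rw [sum_smul_gellMannX]
      ext i j
      have h1 : starRingEnd ℂ (A j i) = A i j := congrFun₂ hermitian i j
      have h2 : A j i = A i j := congrFun₂ symmetric i j
      rw [h2, Complex.conj_eq_iff_re] at h1
      simp [h2, h1]
    rw [expand]
    refine Submodule.sum_mem _ fun i _ => Submodule.sum_mem _ fun j _ => ?_
    rcases lt_trichotomy i j with h | rfl | h
    · exact Submodule.smul_mem _ _ (Submodule.subset_span ⟨i, j, h, rfl⟩)
    · simp [hdiag]
    · exact Submodule.smul_mem _ _ (Submodule.subset_span ⟨j, i, h, gellMannX_comm i j⟩)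

lemma span_gellMannY : Submodule.span ℝ {A | ∃ i j : Fin n, i < j ∧ A = gellMannY i j} =
    imagAntisymm (Fin n) := by
  apply le_antisymm
  · rw [Submodule.span_le]
    rintro _ ⟨i, j, -, rfl⟩
    refine ⟨?_, ?_⟩
    · simp [gellMannY, Matrix.conjTranspose_single, ← smul_neg, neg_div]
    · simp [gellMannY, Matrix.transpose_single, ← smul_neg]
  · rintro A ⟨hermitian, antisymmetric⟩
    have expand : A = ∑ i, ∑ j, (-(A i j).im) • gellMannY i j := by
      rw [sum_smul_gellMannY]
      ext i j
      have h1 : starRingEnd ℂ (A j i) = A i j := congrFun₂ hermitian i j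
      have h2 : A j i = -A i j := congrFun₂ antisymmetric i j
      rw [h2, map_neg, neg_eq_iff_eq_neg] at h1
      have h3 : (A i j).re = 0 := by
        have := congrArg Complex.re h1
        rw [Complex.conj_re, Complex.neg_re] at this
        linarith
      apply Complex.ext <;> simp [h2, h3]
    rw [expand]
    refine Submodule.sum_mem _ fun i _ => Submodule.sum_mem _ fun j _ => Submodule.smul_mem _ _ ?_
    rcases lt_trichotomy i j with h | rfl | h
    · exact Submodule.subset_span ⟨i, j, h, rfl⟩
    · simp [gellMannY]
    · rw [gellMannY_swap]
      exact Submodule.neg_mem _ (Submodule.subset_span ⟨j, i, h, rfl⟩)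

lemma gellMannZ_eq_smul_diagonal (j : Fin n) : gellMannZ j =
    (Real.sqrt (2 * ((j : ℝ) + 1) * (j : ℝ)))⁻¹ •
      Matrix.diagonal fun a => (if a < j then 1 else 0) - if a = j then ((j : ℕ) : ℂ) else 0 := by
  ext a b
  simp only [gellMannZ, Matrix.smul_apply, Matrix.sub_apply, Matrix.sum_apply, Complex.real_smul,
    Complex.ofReal_inv, smul_eq_mul]
  congr 1
  rcases eq_or_ne a b with rfl | hab
  · simp [Matrix.single_apply, eq_comm]
  · have off : ∀ i, Matrix.single i i (1 : ℂ) a b = 0 := fun i =>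
      Matrix.single_apply_of_ne _ _ _ _ _ fun h => hab (h.1.symm.trans h.2)
    simp [off, hab]

lemma gellMannZ_mem (j : Fin n) : gellMannZ j ∈ realDiagTraceless (Fin n) := by
  rw [gellMannZ_eq_smul_diagonal]
  refine Submodule.smul_mem _ _ ⟨?_, Matrix.isDiag_diagonal _, ?_⟩
  · rw [Matrix.diagonal_conjTranspose]
    congr 1
    ext a
    simp [apply_ite (starRingEnd ℂ)]
  · simp [Matrix.trace_diagonal, Finset.sum_sub_distrib, Finset.filter_gt_eq_Iio]

lemma exists_smul_gellMannZ_apply_self {j : Fin n} (hj : 0 < (j : ℕ)) (r : ℝ) :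
    ∃ t : ℝ, (t • gellMannZ j) j j = r := by
  have : (0 : ℝ) < (j : ℕ) := Nat.cast_pos.mpr hj
  refine ⟨-(r * Real.sqrt (2 * ((j : ℝ) + 1) * (j : ℝ)) / (j : ℕ)), ?_⟩
  rw [gellMannZ_eq_smul_diagonal, smul_smul, Matrix.smul_apply, Matrix.diagonal_apply_eq,
    if_neg (lt_irrefl _), if_pos rfl, Complex.real_smul, ← Complex.ofReal_natCast, zero_sub,
    ← Complex.ofReal_neg, ← Complex.ofReal_mul]
  congr 1
  field_simp

lemma mem_span_gellMannZ (k : ℕ) {A : Matrix (Fin n) (Fin n) ℂ}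
    (hA : A ∈ realDiagTraceless (Fin n)) (hk : ∀ a : Fin n, k < a → A a a = 0) :
    A ∈ Submodule.span ℝ {A | ∃ j : Fin n, 0 < (j : ℕ) ∧ A = gellMannZ j} := by
  induction k generalizing A with
  | zero =>
    obtain ⟨-, diagonal, traceless⟩ := hA
    have hzero : A = 0 := by
      ext a b
      rcases eq_or_ne a b with rfl | h
      · by_cases ha : 0 < (a : ℕ)
        · exact hk a ha
        · have rest (b : Fin n) (hb : b ≠ a) : A.diag b = 0 :=
            hk b (by have := Fin.val_ne_of_ne hb; omega)
          rwa [Matrix.trace, Fintype.sum_eq_single a rest] at traceless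
      · exact diagonal h
    rw [hzero]
    exact Submodule.zero_mem _
  | succ k ih =>
    by_cases hkn : k + 1 < n
    · set j : Fin n := ⟨k + 1, hkn⟩
      have hre : ((A j j).re : ℂ) = A j j := Complex.conj_eq_iff_re.mp (congrFun₂ hA.1 j j)
      obtain ⟨t, ht⟩ := exists_smul_gellMannZ_apply_self (j := j) k.succ_pos (A j j).re
      have hsub := ih (A := A - t • gellMannZ j)
        (Submodule.sub_mem _ hA (Submodule.smul_mem _ _ (gellMannZ_mem j))) fun a ha => by
          rcases eq_or_ne a j with rfl | haj
          · rw [Matrix.sub_apply, ht, hre, sub_self]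
          · have hak : (a : ℕ) ≠ k + 1 := fun h => haj (Fin.ext h)
            have hlt : j < a := Fin.lt_def.mpr (by simp only [j]; omega)
            simp [hk a (by omega), gellMannZ_eq_smul_diagonal, hlt.not_gt, haj]
      rw [← sub_add_cancel A (t • gellMannZ j)]
      exact Submodule.add_mem _ hsub
        (Submodule.smul_mem _ _ (Submodule.subset_span ⟨j, k.succ_pos, rfl⟩))
    · exact ih hA fun a ha => hk a (by omega)

lemma span_gellMannZ : Submodule.span ℝ {A | ∃ j : Fin n, 0 < (j : ℕ) ∧ A = gellMannZ j} =
    realDiagTraceless (Fin n) := by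
  apply le_antisymm
  · rw [Submodule.span_le]
    rintro _ ⟨j, -, rfl⟩
    exact gellMannZ_mem j
  · exact fun A hA => mem_span_gellMannZ n hA fun a ha => absurd a.2 (by omega)

end GellMann

section Reindex

variable {ι κ : Type*} (e : ι ≃ κ)

lemma reindex_mem_realSymmOffDiag {A : Matrix ι ι ℂ} :
    Matrix.reindex e e A ∈ realSymmOffDiag κ ↔ A ∈ realSymmOffDiag ι :=
  and_congr (Equiv.apply_eq_iff_eq (Matrix.reindex e e) (x := Aᴴ) (y := A)) <|
    and_congr (Equiv.apply_eq_iff_eq (Matrix.reindex e e) (x := Aᵀ) (y := A)) <|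
      e.symm.forall_congr_right (q := fun x => A x x = 0)

lemma reindex_mem_imagAntisymm {A : Matrix ι ι ℂ} :
    Matrix.reindex e e A ∈ imagAntisymm κ ↔ A ∈ imagAntisymm ι :=
  and_congr (Equiv.apply_eq_iff_eq (Matrix.reindex e e) (x := Aᴴ) (y := A))
    (Equiv.apply_eq_iff_eq (Matrix.reindex e e) (x := Aᵀ) (y := -A))

lemma reindex_mem_realDiagTraceless [Fintype ι] [Fintype κ] {A : Matrix ι ι ℂ} :
    Matrix.reindex e e A ∈ realDiagTraceless κ ↔ A ∈ realDiagTraceless ι := by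
  refine and_congr (Equiv.apply_eq_iff_eq (Matrix.reindex e e) (x := Aᴴ) (y := A))
    (and_congr ?_ ?_)
  · exact ⟨fun h x y hxy => by simpa using h (e.injective.ne hxy),
      fun h => h.submatrix e.symm.injective⟩
  · rw [show (Matrix.reindex e e A).trace = A.trace from e.symm.sum_comp fun x => A x x]

end Reindex

lemma span_toQubits_image {S : Set (Matrix (Fin (2 ^ m)) (Fin (2 ^ m)) ℂ)}
    {W : Submodule ℝ (Matrix (Qubits m) (Qubits m) ℂ)}
    (hW : ∀ A, toQubits A ∈ W ↔ A ∈ Submodule.span ℝ S) :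
    Submodule.span ℝ (toQubits '' S) = W := by
  let e := Matrix.reindexLinearEquiv ℝ ℂ (finFunctionFinEquiv (m := 2) (n := m)).symm
    (finFunctionFinEquiv (m := 2) (n := m)).symm
  change Submodule.span ℝ (e.toLinearMap '' S) = W
  rw [← Submodule.map_span, ← Submodule.map_comap_eq_of_surjective e.surjective W]
  congr 1
  ext A
  exact (hW A).symm

theorem span_toQubits_gellMannX :
    Submodule.span ℝ {A | ∃ i j : Fin (2 ^ m), i < j ∧ A = toQubits (gellMannX i j)} =
      realSymmOffDiag (Qubits m) := by
  rw [← span_toQubits_image (S := {A | ∃ i j : Fin (2 ^ m), i < j ∧ A = gellMannX i j})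
    (W := realSymmOffDiag (Qubits m))
    fun A => span_gellMannX ▸ reindex_mem_realSymmOffDiag finFunctionFinEquiv.symm]
  congr 1
  ext A
  constructor
  · rintro ⟨i, j, hij, rfl⟩
    exact ⟨_, ⟨i, j, hij, rfl⟩, rfl⟩
  · rintro ⟨_, ⟨i, j, hij, rfl⟩, rfl⟩
    exact ⟨i, j, hij, rfl⟩

theorem span_toQubits_gellMannY :
    Submodule.span ℝ {A | ∃ i j : Fin (2 ^ m), i < j ∧ A = toQubits (gellMannY i j)} =
      imagAntisymm (Qubits m) := by
  rw [← span_toQubits_image (S := {A | ∃ i j : Fin (2 ^ m), i < j ∧ A = gellMannY i j})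
    (W := imagAntisymm (Qubits m))
    fun A => span_gellMannY ▸ reindex_mem_imagAntisymm finFunctionFinEquiv.symm]
  congr 1
  ext A
  constructor
  · rintro ⟨i, j, hij, rfl⟩
    exact ⟨_, ⟨i, j, hij, rfl⟩, rfl⟩
  · rintro ⟨_, ⟨i, j, hij, rfl⟩, rfl⟩
    exact ⟨i, j, hij, rfl⟩

theorem span_toQubits_gellMannZ :
    Submodule.span ℝ {A | ∃ j : Fin (2 ^ m), 0 < (j : ℕ) ∧ A = toQubits (gellMannZ j)} =
      realDiagTraceless (Qubits m) := by
  rw [← span_toQubits_image (S := {A | ∃ j : Fin (2 ^ m), 0 < (j : ℕ) ∧ A = gellMannZ j})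
    (W := realDiagTraceless (Qubits m))
    fun A => span_gellMannZ ▸ reindex_mem_realDiagTraceless finFunctionFinEquiv.symm]
  congr 1
  ext A
  constructor
  · rintro ⟨j, hj, rfl⟩
    exact ⟨_, ⟨j, hj, rfl⟩, rfl⟩
  · rintro ⟨_, ⟨j, hj, rfl⟩, rfl⟩
    exact ⟨j, hj, rfl⟩

/-! ### The compact symplectic group and the Kraus map -/

section Kraus

variable {l : Type} [Fintype l]

/-- The normalization `√(2n)` of the singlet. -/
noncomputable def sqrtDim (l : Type) [Fintype l] : ℂ := (Real.sqrt (Fintype.card (l ⊕ l)) : ℂ)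

lemma sqrtDim_mul_self : sqrtDim l * sqrtDim l = Fintype.card (l ⊕ l) := by
  rw [sqrtDim, ← Complex.ofReal_mul, Real.mul_self_sqrt (Nat.cast_nonneg _),
    Complex.ofReal_natCast]

lemma sqrtDim_ne_zero [Nonempty l] : sqrtDim l ≠ 0 := fun h =>
  Fintype.card_ne_zero (α := l ⊕ l) <| Nat.cast_injective (R := ℂ) <| by
    rw [← sqrtDim_mul_self, h, mul_zero, Nat.cast_zero]

lemma conj_sqrtDim : starRingEnd ℂ (sqrtDim l) = sqrtDim l := Complex.conj_ofReal _

lemma siteSym_mem_onSite (g : Matrix (l ⊕ l) (l ⊕ l) ℂ) {s : Matrix (l ⊕ l) (l ⊕ l) ℂ}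
    (hs : s ∈ onSite l) : siteSym g s ∈ onSite l := by
  have symmetric : sᵀ = s := hs
  change (g * s * gᵀ)ᵀ = g * s * gᵀ
  rw [Matrix.transpose_mul, Matrix.transpose_mul, symmetric, Matrix.transpose_transpose,
    Matrix.mul_assoc]

variable [DecidableEq l]

lemma J_mul_J_mul (A : Matrix (l ⊕ l) (l ⊕ l) ℂ) :
    Matrix.J l ℂ * (Matrix.J l ℂ * A) = -A := by
  rw [← mul_assoc, Matrix.J_squared, neg_one_mul]

lemma J_conjTranspose {l : Type} [DecidableEq l] : (Matrix.J l ℂ)ᴴ = -Matrix.J l ℂ := by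
  rw [← Matrix.J_transpose]
  exact congrArg Matrix.transpose (Matrix.map_J _ (starRingEnd ℂ))

lemma mem_sp_iff_transpose {A : Matrix (l ⊕ l) (l ⊕ l) ℂ} :
    A ∈ LieAlgebra.Symplectic.sp l ℂ ↔ (Matrix.J l ℂ * A)ᵀ = Matrix.J l ℂ * A := by
  rw [LieAlgebra.Symplectic.sp, mem_skewAdjointMatricesLieSubalgebra,
    mem_skewAdjointMatricesSubmodule, Matrix.transpose_mul, Matrix.J_transpose, mul_neg,
    neg_eq_iff_eq_neg, ← mul_neg]
  rfl

lemma mem_sp_iff {A : Matrix (l ⊕ l) (l ⊕ l) ℂ} :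
    A ∈ LieAlgebra.Symplectic.sp l ℂ ↔ Matrix.J l ℂ * Aᵀ = -(A * Matrix.J l ℂ) := by
  have unit : IsUnit (Matrix.J l ℂ) := .of_mul_eq_one (-Matrix.J l ℂ) (by simp [Matrix.J_squared])
  rw [mem_sp_iff_transpose, Matrix.transpose_mul, Matrix.J_transpose, mul_neg,
    ← unit.mul_right_inj, ← unit.mul_left_inj, J_mul_J_mul, mul_neg, neg_mul, mul_assoc, mul_assoc,
    Matrix.J_squared, mul_neg, mul_one, mul_neg, neg_neg, neg_mul]

lemma mul_conjTranspose_of_mem_CSp {g : Matrix (l ⊕ l) (l ⊕ l) ℂ} (hg : g ∈ CSp l) :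
    g * gᴴ = 1 :=
  Matrix.mem_unitaryGroup_iff.mp hg.1

lemma conjTranspose_mul_of_mem_CSp {g : Matrix (l ⊕ l) (l ⊕ l) ℂ} (hg : g ∈ CSp l) :
    gᴴ * g = 1 :=
  Matrix.mem_unitaryGroup_iff'.mp hg.1

lemma conjTranspose_mem_CSp {g : Matrix (l ⊕ l) (l ⊕ l) ℂ} (hg : g ∈ CSp l) : gᴴ ∈ CSp l := by
  refine ⟨Unitary.star_mem hg.1, ?_⟩
  rw [← Matrix.inv_eq_left_inv (conjTranspose_mul_of_mem_CSp hg)]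
  exact SymplecticGroup.coe_inv' ⟨g, hg.2⟩ ▸ (⟨g, hg.2⟩⁻¹ : Matrix.symplecticGroup l ℂ).2

lemma mul_J_of_mem_CSp {g : Matrix (l ⊕ l) (l ⊕ l) ℂ} (hg : g ∈ CSp l) :
    g * Matrix.J l ℂ = Matrix.J l ℂ * g.map (starRingEnd ℂ) := by
  have transpose_mul_conj : gᵀ * g.map (starRingEnd ℂ) = 1 := by
    rw [← Matrix.transpose_one, ← conjTranspose_mul_of_mem_CSp hg, Matrix.transpose_mul]
    rfl
  rw [← mul_one (g * _), ← transpose_mul_conj, ← mul_assoc, SymplecticGroup.mem_iff.mp hg.2]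

lemma mem_CSp_iff {g : Matrix (l ⊕ l) (l ⊕ l) ℂ} :
    g ∈ CSp l ↔ g * gᴴ = 1 ∧ Matrix.J l ℂ * gᵀ = gᴴ * Matrix.J l ℂ := by
  refine ⟨fun hg => ⟨mul_conjTranspose_of_mem_CSp hg, ?_⟩, fun ⟨unitary, J_mul⟩ =>
    ⟨Matrix.mem_unitaryGroup_iff.mpr unitary, SymplecticGroup.mem_iff.mpr ?_⟩⟩
  · rw [mul_J_of_mem_CSp (conjTranspose_mem_CSp hg)]
    congr 1
    ext a b
    exact (Complex.conj_conj _).symm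
  · rw [mul_assoc, J_mul, ← mul_assoc, unitary, one_mul]

lemma krausOp_eq (s : Matrix (l ⊕ l) (l ⊕ l) ℂ) :
    krausOp s = -(sqrtDim l)⁻¹ • (Matrix.J l ℂ * s.map (starRingEnd ℂ)) := rfl

lemma krausOp_sum_smul {ι : Type*} (S : Finset ι) (c : ι → ℂ)
    (s : ι → Matrix (l ⊕ l) (l ⊕ l) ℂ) :
    krausOp (∑ i ∈ S, c i • s i) = ∑ i ∈ S, starRingEnd ℂ (c i) • krausOp (s i) := by
  have map_sum : (∑ i ∈ S, c i • s i).map (starRingEnd ℂ) =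
      ∑ i ∈ S, starRingEnd ℂ (c i) • (s i).map (starRingEnd ℂ) := by
    ext a b
    simp [Matrix.sum_apply]
  simp only [krausOp_eq, map_sum, Matrix.mul_sum, Finset.smul_sum, Matrix.mul_smul]
  exact Finset.sum_congr rfl fun i _ => smul_comm _ _ _

/-- The inverse of the map `krausOp` from on-site vectors to operators on the virtual space. -/
noncomputable def krausInv (A : Matrix (l ⊕ l) (l ⊕ l) ℂ) : Matrix (l ⊕ l) (l ⊕ l) ℂ :=
  sqrtDim l • (Matrix.J l ℂ * A).map (starRingEnd ℂ)

lemma krausOp_krausInv [Nonempty l] (A : Matrix (l ⊕ l) (l ⊕ l) ℂ) :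
    krausOp (krausInv A) = A := by
  have map_map : (krausInv A).map (starRingEnd ℂ) = sqrtDim l • (Matrix.J l ℂ * A) := by
    ext a b
    simp only [krausInv, Matrix.map_apply, Matrix.smul_apply, smul_eq_mul, map_mul, conj_sqrtDim,
      Complex.conj_conj]
  rw [krausOp_eq, map_map, Matrix.mul_smul, smul_smul, J_mul_J_mul, neg_mul,
    inv_mul_cancel₀ sqrtDim_ne_zero, neg_smul, one_smul, neg_neg]

lemma krausInv_krausOp [Nonempty l] (s : Matrix (l ⊕ l) (l ⊕ l) ℂ) :
    krausInv (krausOp s) = s := by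
  rw [krausInv, krausOp_eq, Matrix.mul_smul, J_mul_J_mul, smul_neg, neg_smul, neg_neg]
  ext a b
  simp [conj_sqrtDim, mul_inv_cancel_left₀ (sqrtDim_ne_zero (l := l))]

lemma krausOp_injective [Nonempty l] :
    Function.Injective (krausOp : Matrix (l ⊕ l) (l ⊕ l) ℂ → _) :=
  Function.LeftInverse.injective krausInv_krausOp

lemma krausOp_mem_sp {s : Matrix (l ⊕ l) (l ⊕ l) ℂ} (hs : s ∈ onSite l) :
    krausOp s ∈ LieAlgebra.Symplectic.sp l ℂ := by
  have symmetric : sᵀ = s := hs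
  rw [mem_sp_iff_transpose, krausOp_eq, Matrix.mul_smul, J_mul_J_mul, Matrix.transpose_smul,
    Matrix.transpose_neg, ← Matrix.transpose_map, symmetric]

lemma krausInv_mem_onSite {A : Matrix (l ⊕ l) (l ⊕ l) ℂ}
    (hA : A ∈ LieAlgebra.Symplectic.sp l ℂ) : krausInv A ∈ onSite l := by
  change (krausInv A)ᵀ = krausInv A
  rw [krausInv, Matrix.transpose_smul, ← Matrix.transpose_map, mem_sp_iff_transpose.mp hA]

theorem bijOn_krausOp [Nonempty l] :
    Set.BijOn krausOp (onSite l : Set (Matrix (l ⊕ l) (l ⊕ l) ℂ))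
      (LieAlgebra.Symplectic.sp l ℂ : Set (Matrix (l ⊕ l) (l ⊕ l) ℂ)) :=
  Set.InvOn.bijOn (f' := krausInv) ⟨fun s _ => krausInv_krausOp s, fun A _ => krausOp_krausInv A⟩
    (fun _ hs => krausOp_mem_sp hs) (fun _ hA => krausInv_mem_onSite hA)

theorem krausOp_siteSym {g : Matrix (l ⊕ l) (l ⊕ l) ℂ} (hg : g ∈ CSp l)
    (s : Matrix (l ⊕ l) (l ⊕ l) ℂ) : krausOp (siteSym g s) = g * krausOp s * gᴴ := by
  have map_siteSym : (siteSym g s).map (starRingEnd ℂ) =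
      g.map (starRingEnd ℂ) * s.map (starRingEnd ℂ) * gᴴ := by
    rw [siteSym, Matrix.map_mul, Matrix.map_mul]
    rfl
  rw [krausOp_eq, krausOp_eq, map_siteSym, ← mul_assoc, ← mul_assoc, ← mul_J_of_mem_CSp hg,
    Matrix.mul_smul, Matrix.smul_mul, ← mul_assoc]

lemma conj_mem_sp [Nonempty l] {g A : Matrix (l ⊕ l) (l ⊕ l) ℂ} (hg : g ∈ CSp l)
    (hA : A ∈ LieAlgebra.Symplectic.sp l ℂ) : g * A * gᴴ ∈ LieAlgebra.Symplectic.sp l ℂ := by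
  rw [← krausOp_krausInv A, ← krausOp_siteSym hg]
  exact krausOp_mem_sp (siteSym_mem_onSite g (krausInv_mem_onSite hA))

end Kraus

/-! ### The Pauli generators and the on-site basis -/

lemma card_virtual_cast : (Fintype.card (Qubits m ⊕ Qubits m) : ℂ) = 2 ^ (m + 1) := by
  rw [card_virtual, ← pow_succ']
  push_cast
  rfl

lemma gen_conjTranspose (a : Gen m) : (gen a)ᴴ = gen a := pauliOp_conjTranspose _

lemma gen_mul_self (a : Gen m) : gen a * gen a = 1 := pauliOp_mul_self _

lemma trace_gen_mul_gen (a b : Gen m) :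
    (gen a * gen b).trace = if a = b then 2 ^ (m + 1) else 0 := by
  simp only [gen, trace_pauliOp_mul_pauliOp, Subtype.ext_iff]

lemma gen_mem_sp (a : Gen m) : gen a ∈ LieAlgebra.Symplectic.sp (Qubits m) ℂ := by
  rw [mem_sp_iff, gen, J_mul_pauliOp_transpose, sympSign_gen, Units.neg_smul, one_smul]

lemma eq_sum_gen {A : Matrix (Qubits m ⊕ Qubits m) (Qubits m ⊕ Qubits m) ℂ}
    (hA : A ∈ LieAlgebra.Symplectic.sp (Qubits m) ℂ) :
    A = ∑ a, ((gen a * A).trace / 2 ^ (m + 1)) • gen a := by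
  conv_lhs => rw [eq_sum_pauliOp A]
  symm
  refine (Finset.sum_coe_sort (genLabels m)
    fun a => ((pauliOp a * A).trace / 2 ^ (m + 1)) • pauliOp a).trans ?_
  refine Finset.sum_subset (Finset.subset_univ _) fun a _ ha => ?_
  have sign : sympSign a = 1 :=
    (Int.units_eq_one_or _).resolve_right fun h => ha (mem_genLabels.mpr h)
  have orthogonal : (pauliOp a * A).trace = 0 :=
    trace_mul_eq_zero_of_mul_transpose (K := -Matrix.J (Qubits m) ℂ)
      (by rw [neg_mul, Matrix.J_squared, neg_neg])
      (by rw [J_mul_pauliOp_transpose, sign, one_smul]) (mem_sp_iff.mp hA)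
  rw [orthogonal, zero_div, zero_smul]

lemma trace_krausInv {l : Type} [Fintype l] [DecidableEq l] (A B : Matrix (l ⊕ l) (l ⊕ l) ℂ) :
    ((krausInv A)ᴴ * krausInv B).trace = Fintype.card (l ⊕ l) * (Bᴴ * A).trace := by
  have conjTranspose_krausInv : (krausInv A)ᴴ = sqrtDim l • (Matrix.J l ℂ * A)ᵀ := by
    rw [krausInv, Matrix.conjTranspose_smul, ← starRingEnd_apply, conj_sqrtDim]
    congr 1
    ext a b
    exact Complex.conj_conj _
  rw [conjTranspose_krausInv, krausInv, Matrix.smul_mul, Matrix.mul_smul, smul_smul,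
    sqrtDim_mul_self, Matrix.trace_smul, smul_eq_mul, ← Matrix.trace_transpose,
    Matrix.transpose_mul, Matrix.transpose_transpose]
  change _ * ((Matrix.J l ℂ * B)ᴴ * (Matrix.J l ℂ * A)).trace = _
  rw [Matrix.conjTranspose_mul, J_conjTranspose, mul_assoc, neg_mul, J_mul_J_mul, neg_neg]

lemma siteVec_eq (a : Gen m) :
    siteVec a = (2 ^ (m + 1) : ℂ)⁻¹ • krausInv (gen a) := by
  rw [krausInv, smul_smul, ← card_virtual_cast, ← sqrtDim_mul_self, mul_inv, mul_assoc,
    inv_mul_cancel₀ sqrtDim_ne_zero, mul_one]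
  rfl

lemma siteVec_mem (a : Gen m) : siteVec a ∈ onSite (Qubits m) := by
  rw [siteVec_eq]
  exact Submodule.smul_mem _ _ (krausInv_mem_onSite (gen_mem_sp a))

lemma krausOp_siteVec (a : Gen m) : krausOp (siteVec a) = (2 ^ (m + 1) : ℂ)⁻¹ • gen a := by
  have h := krausOp_sum_smul {a} (fun _ => (2 ^ (m + 1) : ℂ)⁻¹) fun a => krausInv (gen a)
  simpa only [Finset.sum_singleton, krausOp_krausInv, ← siteVec_eq, map_inv₀, map_pow,
    map_ofNat] using h

theorem trace_siteVec (a b : Gen m) :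
    ((siteVec a)ᴴ * siteVec b).trace = if a = b then 1 else 0 := by
  rw [siteVec_eq, siteVec_eq, Matrix.conjTranspose_smul, Matrix.smul_mul, Matrix.mul_smul,
    Matrix.trace_smul, Matrix.trace_smul, trace_krausInv, gen_conjTranspose, trace_gen_mul_gen,
    card_virtual_cast]
  rcases eq_or_ne a b with rfl | hab
  · simp
  · simp [hab, hab.symm]

theorem span_siteVec :
    Submodule.span ℂ (Set.range (siteVec (m := m))) = onSite (Qubits m) := by
  apply le_antisymm
  · rw [Submodule.span_le]
    rintro _ ⟨a, rfl⟩
    exact siteVec_mem a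
  · intro s hs
    have expand : s = ∑ a, starRingEnd ℂ (gen a * krausOp s).trace • siteVec a := by
      apply krausOp_injective
      conv_lhs => rw [eq_sum_gen (krausOp_mem_sp hs)]
      simp only [krausOp_sum_smul, krausOp_siteVec, Complex.conj_conj, smul_smul, div_eq_mul_inv]
    rw [expand]
    exact Submodule.sum_mem _ fun a _ =>
      Submodule.smul_mem _ _ (Submodule.subset_span (Set.mem_range_self a))

lemma trace_siteVec_mul_sum (c : Gen m → ℂ) (a : Gen m) :
    ((siteVec a)ᴴ * ∑ b, c b • siteVec b).trace = c a := by
  simp [Finset.mul_sum, Matrix.trace_sum, Matrix.trace_smul, trace_siteVec]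

theorem finrank_onSite : Module.finrank ℂ (onSite (Qubits m)) = 2 ^ m * (2 * 2 ^ m + 1) := by
  have independent : LinearIndependent ℂ (siteVec (m := m)) :=
    Fintype.linearIndependent_iff.mpr fun c hc a => by
      rw [← trace_siteVec_mul_sum c a, hc, mul_zero, Matrix.trace_zero]
  rw [← span_siteVec, finrank_span_eq_card independent, card_gen]

lemma sum_norm_sq_trace_siteVec {s : Matrix (Qubits m ⊕ Qubits m) (Qubits m ⊕ Qubits m) ℂ}
    (hs : s ∈ onSite (Qubits m)) :
    ∑ b, ‖((siteVec b)ᴴ * s).trace‖ ^ 2 = ∑ x, ∑ y, ‖s x y‖ ^ 2 := by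
  rw [← span_siteVec] at hs
  obtain ⟨c, hc⟩ := (Submodule.mem_span_range_iff_exists_fun ℂ).mp hs
  have trace_eq : (sᴴ * s).trace = ∑ b, starRingEnd ℂ (c b) * c b := by
    conv_lhs => rw [← hc]
    simp only [Matrix.conjTranspose_sum, Matrix.conjTranspose_smul, Matrix.sum_mul,
      Matrix.smul_mul, Matrix.trace_sum, Matrix.trace_smul, trace_siteVec_mul_sum]
    rfl
  have trace_eq' : (sᴴ * s).trace = ∑ y, ∑ x, starRingEnd ℂ (s x y) * s x y := rfl
  rw [← hc]
  simp only [trace_siteVec_mul_sum]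
  rw [hc, Finset.sum_comm]
  rw [trace_eq'] at trace_eq
  simp only [Complex.conj_mul'] at trace_eq
  exact_mod_cast trace_eq.symm

/-! ### The adjoint representation -/

section Adjoint

variable {g : Matrix (Qubits m ⊕ Qubits m) (Qubits m ⊕ Qubits m) ℂ}

lemma star_adjMatrix_apply (g : Matrix (Qubits m ⊕ Qubits m) (Qubits m ⊕ Qubits m) ℂ)
    (a b : Gen m) : star (adjMatrix g a b) = adjMatrix g a b := by
  rw [adjMatrix, Matrix.of_apply, star_div₀, star_natCast, ← Matrix.trace_conjTranspose]
  simp only [Matrix.conjTranspose_mul, Matrix.conjTranspose_conjTranspose, gen_conjTranspose]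
  rw [← mul_assoc, ← mul_assoc, Matrix.trace_mul_comm, ← mul_assoc, ← mul_assoc]

lemma sum_adjMatrix_smul_gen (hg : g ∈ CSp (Qubits m)) (a : Gen m) :
    ∑ b, adjMatrix g a b • gen b = gᴴ * gen a * g := by
  have h := eq_sum_gen (conj_mem_sp (conjTranspose_mem_CSp hg) (gen_mem_sp a))
  rw [Matrix.conjTranspose_conjTranspose] at h
  rw [h]
  refine Finset.sum_congr rfl fun b _ => ?_
  rw [adjMatrix, Matrix.of_apply, gen_conjTranspose, card_virtual_cast, Matrix.trace_mul_comm,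
    ← mul_assoc, ← mul_assoc, Matrix.trace_mul_comm (gen b)]

theorem adjMatrix_mem_unitaryGroup (hg : g ∈ CSp (Qubits m)) :
    adjMatrix g ∈ Matrix.unitaryGroup (Gen m) ℂ := by
  rw [Matrix.mem_unitaryGroup_iff]
  ext a c
  calc (adjMatrix g * star (adjMatrix g)) a c
      = ∑ b, adjMatrix g a b * (gen c * g * gen b * gᴴ).trace / 2 ^ (m + 1) := by
        refine Finset.sum_congr rfl fun b _ => ?_
        change adjMatrix g a b * star (adjMatrix g c b) = _
        rw [star_adjMatrix_apply, mul_div_assoc, ← card_virtual_cast,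
          adjMatrix, Matrix.of_apply, Matrix.of_apply, gen_conjTranspose, gen_conjTranspose]
    _ = (gen c * (g * (∑ b, adjMatrix g a b • gen b) * gᴴ)).trace / 2 ^ (m + 1) := by
        simp only [Matrix.mul_sum, Matrix.sum_mul, Matrix.mul_smul, Matrix.smul_mul,
          Matrix.trace_sum, Matrix.trace_smul, Finset.sum_div, smul_eq_mul, ← mul_assoc]
    _ = (gen c * gen a).trace / 2 ^ (m + 1) := by
        rw [sum_adjMatrix_smul_gen hg, ← mul_assoc g, ← mul_assoc g,
          mul_conjTranspose_of_mem_CSp hg, one_mul, mul_assoc (gen a),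
          mul_conjTranspose_of_mem_CSp hg, mul_one]
    _ = (1 : Matrix (Gen m) (Gen m) ℂ) a c := by
        rw [trace_gen_mul_gen, Matrix.one_apply]
        simp [ite_div, eq_comm]

lemma rotVec_mem (g : Matrix (Qubits m ⊕ Qubits m) (Qubits m ⊕ Qubits m) ℂ) (a : Gen m) :
    rotVec g a ∈ onSite (Qubits m) :=
  siteSym_mem_onSite _ (siteVec_mem a)

lemma krausOp_rotVec (hg : g ∈ CSp (Qubits m)) (a : Gen m) :
    krausOp (rotVec g a) = (2 ^ (m + 1) : ℂ)⁻¹ • (gᴴ * gen a * g) := by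
  rw [rotVec, krausOp_siteSym (conjTranspose_mem_CSp hg), krausOp_siteVec,
    Matrix.conjTranspose_conjTranspose, Matrix.mul_smul, Matrix.smul_mul]

theorem rotVec_eq_sum (hg : g ∈ CSp (Qubits m)) (a : Gen m) :
    rotVec g a = ∑ b, starRingEnd ℂ (adjMatrix g a b) • siteVec b := by
  apply krausOp_injective
  simp only [krausOp_sum_smul, Complex.conj_conj, krausOp_siteVec, krausOp_rotVec hg,
    ← sum_adjMatrix_smul_gen hg, Finset.smul_sum]
  exact Finset.sum_congr rfl fun b _ => smul_comm _ _ _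

end Adjoint

/-! ### The AKLT state as a matrix product state -/

lemma sum_fin_cons {α M : Type*} [Fintype α] [AddCommMonoid M] {N : ℕ}
    (f : (Fin (N + 1) → α) → M) :
    ∑ x, f x = ∑ a, ∑ x : Fin N → α, f (Fin.cons a x) := by
  rw [← (Fin.consEquiv fun _ => α).sum_comp, Fintype.sum_prod_type]
  rfl

lemma cons_ite_swap {α : Type*} {N : ℕ} (t : Bool) (τ : Fin N → Bool) (a : α × α)
    (x : Fin N → α × α) :
    (fun k => if (Fin.cons t τ : Fin (N + 1) → Bool) k
      then ((Fin.cons a x : Fin (N + 1) → α × α) k).swap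
      else (Fin.cons a x : Fin (N + 1) → α × α) k) =
      Fin.cons (if t then a.swap else a) fun k => if τ k then (x k).swap else x k := by
  ext1 k
  refine Fin.cases ?_ (fun k => ?_) k <;> simp

section MPS

variable {l : Type} [Fintype l] [DecidableEq l] {N : ℕ}

lemma bonds_succ (L : l ⊕ l → ℂ) (a : (l ⊕ l) × (l ⊕ l)) (x : Fin N → (l ⊕ l) × (l ⊕ l))
    (e : l ⊕ l) :
    bonds (N + 1) L (Fin.cons a x) e = L a.1 * bonds N (singlet l a.2) x e := by
  have left_spins :
      (Fin.snoc (fun k => ((Fin.cons a x : Fin (N + 1) → (l ⊕ l) × (l ⊕ l)) k).1) e :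
        Fin (N + 2) → l ⊕ l) =
      Fin.cons a.1 (Fin.snoc (fun k => (x k).1) e : Fin (N + 1) → l ⊕ l) := by
    rw [Fin.cons_snoc_eq_snoc_cons]
    congr 1
    ext k
    refine Fin.cases ?_ (fun k => ?_) k <;> simp
  simp only [bonds]
  rw [left_spins, Fin.prod_univ_succ]
  simp

lemma aklt_zero (L : l ⊕ l → ℂ) (x : Fin 0 → (l ⊕ l) × (l ⊕ l)) : aklt 0 L x = L := by
  ext e
  simp [aklt, bonds, Fin.snoc]

lemma isLinearMap_aklt (x : Fin N → (l ⊕ l) × (l ⊕ l)) :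
    IsLinearMap ℂ fun L : l ⊕ l → ℂ => aklt N L x where
  map_add L L' := by
    ext e
    simp [aklt, bonds, add_mul, Finset.sum_add_distrib, mul_add]
  map_smul c L := by
    ext e
    simp only [aklt, bonds, Pi.smul_apply, smul_eq_mul, mul_assoc c, ← Finset.mul_sum]
    exact mul_left_comm _ _ _

lemma isLinearMap_contract_aklt (s : Fin N → Matrix (l ⊕ l) (l ⊕ l) ℂ) :
    IsLinearMap ℂ fun L : l ⊕ l → ℂ => contract s (aklt N L) where
  map_add L L' := by
    ext e
    simp only [contract, (isLinearMap_aklt _).map_add, Pi.add_apply, mul_add,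
      Finset.sum_add_distrib]
  map_smul c L := by
    ext e
    simp only [contract, (isLinearMap_aklt _).map_smul, Pi.smul_apply, smul_eq_mul,
      mul_left_comm _ c, ← Finset.mul_sum]

/-- The left virtual spin of the second site, once the two virtual spins of the first site have
been projected onto the symmetric part of the basis state `a`. -/
noncomputable def nextSpin (L : l ⊕ l → ℂ) (a : (l ⊕ l) × (l ⊕ l)) : l ⊕ l → ℂ :=
  (1 / 2 : ℂ) • (L a.1 • singlet l a.2 + L a.2 • singlet l a.1)

lemma nextSpin_mem_onSite (L : l ⊕ l → ℂ) (c : l ⊕ l) :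
    (Matrix.of fun a b => nextSpin L (a, b) c) ∈ onSite l := by
  change _ = _
  ext a b
  simp only [Matrix.transpose_apply, Matrix.of_apply, nextSpin, add_comm]

lemma aklt_succ (L : l ⊕ l → ℂ) (a : (l ⊕ l) × (l ⊕ l)) (x : Fin N → (l ⊕ l) × (l ⊕ l)) :
    aklt (N + 1) L (Fin.cons a x) = aklt N (nextSpin L a) x := by
  have linear := isLinearMap_aklt x
  rw [nextSpin, linear.map_smul, linear.map_add, linear.map_smul, linear.map_smul]
  ext e
  rw [aklt, sum_fin_cons]
  simp only [cons_ite_swap, bonds_succ, Fintype.sum_bool, aklt, if_true, Bool.false_eq_true,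
    if_false, Prod.fst_swap, Prod.snd_swap, ← Finset.mul_sum, Pi.smul_apply, Pi.add_apply,
    smul_eq_mul]
  ring

lemma sum_conj_smul_nextSpin {s : Matrix (l ⊕ l) (l ⊕ l) ℂ} (hs : s ∈ onSite l)
    (L : l ⊕ l → ℂ) :
    ∑ a, ∑ b, starRingEnd ℂ (s a b) • nextSpin L (a, b) = krausOp s *ᵥ L := by
  have symmetric (a b) : s a b = s b a := congrFun (congrFun (show sᵀ = s from hs) b) a
  have antisymmetric (a b) : singlet l a b = -singlet l b a := by
    have J_antisymmetric := congrFun (congrFun (Matrix.J_transpose l ℂ) b) a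
    rw [Matrix.transpose_apply, Matrix.neg_apply] at J_antisymmetric
    simp only [singlet, Matrix.smul_apply, J_antisymmetric, smul_neg]
  have krausOp_apply (c b) :
      krausOp s c b = ∑ a, starRingEnd ℂ (s a b) * singlet l a c := by
    have krausOp_eq_neg : krausOp s = -(singlet l * s.map (starRingEnd ℂ)) := by
      rw [krausOp, singlet, Matrix.smul_mul, neg_smul]
    rw [krausOp_eq_neg, Matrix.neg_apply, Matrix.mul_apply, ← Finset.sum_neg_distrib]
    refine Finset.sum_congr rfl fun a _ => ?_
    rw [antisymmetric a c, Matrix.map_apply, mul_comm, mul_neg]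
  have swap_sum (c) : ∑ a, ∑ b, starRingEnd ℂ (s a b) * (L a * singlet l b c) =
      ∑ a, ∑ b, starRingEnd ℂ (s a b) * (L b * singlet l a c) := by
    rw [Finset.sum_comm]
    exact Finset.sum_congr rfl fun a _ => Finset.sum_congr rfl fun b _ => by rw [symmetric]
  ext c
  simp only [Finset.sum_apply, Pi.smul_apply, smul_eq_mul, nextSpin, Pi.add_apply, mul_add,
    Finset.sum_add_distrib, mul_left_comm _ (1 / 2 : ℂ), ← Finset.mul_sum, swap_sum, ← add_mul,
    add_halves, one_mul, Matrix.mulVec, dotProduct, krausOp_apply, Finset.sum_mul]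
  rw [Finset.sum_comm]
  exact Finset.sum_congr rfl fun b _ => Finset.sum_congr rfl fun a _ => by ring

lemma contract_succ (s : Fin (N + 1) → Matrix (l ⊕ l) (l ⊕ l) ℂ) (hs : s 0 ∈ onSite l)
    (L : l ⊕ l → ℂ) :
    contract s (aklt (N + 1) L) =
      contract (fun k => s k.succ) (aklt N (krausOp (s 0) *ᵥ L)) := by
  rw [← sum_conj_smul_nextSpin hs]
  change _ = IsLinearMap.mk' _ (isLinearMap_contract_aklt fun k => s k.succ) _
  simp only [map_sum, map_smul, IsLinearMap.mk'_apply]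
  ext e
  simp only [contract, sum_fin_cons, Fin.prod_univ_succ, Fin.cons_zero, Fin.cons_succ, aklt_succ,
    Finset.sum_apply, Pi.smul_apply, smul_eq_mul, Finset.mul_sum, mul_assoc,
    Fintype.sum_prod_type]

theorem contract_aklt (s : Fin N → Matrix (l ⊕ l) (l ⊕ l) ℂ) (hs : ∀ k, s k ∈ onSite l)
    (L : l ⊕ l → ℂ) :
    contract s (aklt N L) = (List.ofFn fun k => krausOp (s k)).reverse.prod *ᵥ L := by
  induction N generalizing L with
  | zero =>
    ext e
    simp [contract, aklt_zero]
  | succ N ih =>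
    rw [contract_succ s (hs 0), ih _ fun k => hs _, List.ofFn_succ, List.reverse_cons,
      List.prod_append, List.prod_singleton, Matrix.mulVec_mulVec]

end MPS

/-! ### The norm of the AKLT state -/

lemma star_mulVec_dotProduct_mulVec {ι : Type*} [Fintype ι] [DecidableEq ι] {U : Matrix ι ι ℂ}
    (hU : Uᴴ * U = 1) (x y : ι → ℂ) : star (U *ᵥ x) ⬝ᵥ (U *ᵥ y) = star x ⬝ᵥ y := by
  rw [Matrix.star_mulVec, Matrix.dotProduct_mulVec, Matrix.vecMul_vecMul, hU, Matrix.vecMul_one]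

lemma sum_norm_sq_mulVec {ι : Type*} [Fintype ι] [DecidableEq ι] {U : Matrix ι ι ℂ}
    (hU : Uᴴ * U = 1) (v : ι → ℂ) : ∑ e, ‖(U *ᵥ v) e‖ ^ 2 = ∑ e, ‖v e‖ ^ 2 := by
  have norm_sq_eq (w : ι → ℂ) : ((∑ e, ‖w e‖ ^ 2 : ℝ) : ℂ) = star w ⬝ᵥ w := by
    push_cast
    exact Finset.sum_congr rfl fun e _ => (Complex.conj_mul' _).symm
  rw [← Complex.ofReal_inj, norm_sq_eq, norm_sq_eq, star_mulVec_dotProduct_mulVec hU]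

-- Parseval in the basis `siteVec` reduces the norm to the Kraus operators, which are
-- multiples of unitaries there.
lemma sum_norm_sq_nextSpin (L : Qubits m ⊕ Qubits m → ℂ) :
    ∑ a, ∑ c, ‖nextSpin L a c‖ ^ 2 =
      Fintype.card (Gen m) / (2 ^ (m + 1)) ^ 2 * ∑ e, ‖L e‖ ^ 2 := by
  have trace_eq (b : Gen m) (c) :
      ((siteVec b)ᴴ * Matrix.of fun x y => nextSpin L (x, y) c).trace =
        (krausOp (siteVec b) *ᵥ L) c := by
    rw [← sum_conj_smul_nextSpin (siteVec_mem b), Finset.sum_comm]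
    simp only [Finset.sum_apply]
    rfl
  have isometry (b : Gen m) :
      ∑ c, ‖(krausOp (siteVec b) *ᵥ L) c‖ ^ 2 = (∑ e, ‖L e‖ ^ 2) / (2 ^ (m + 1)) ^ 2 := by
    rw [krausOp_siteVec, ← sum_norm_sq_mulVec (U := gen b)
      (by rw [gen_conjTranspose, gen_mul_self]) L, Finset.sum_div]
    simp [Matrix.smul_mulVec, mul_pow, div_eq_inv_mul]
  calc ∑ a, ∑ c, ‖nextSpin L a c‖ ^ 2
      = ∑ c, ∑ x, ∑ y, ‖(Matrix.of fun x y => nextSpin L (x, y) c) x y‖ ^ 2 := by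
        rw [Finset.sum_comm]
        simp only [Fintype.sum_prod_type, Matrix.of_apply]
    _ = ∑ c, ∑ b, ‖(krausOp (siteVec b) *ᵥ L) c‖ ^ 2 := by
        simp only [← sum_norm_sq_trace_siteVec (nextSpin_mem_onSite L _), trace_eq]
    _ = Fintype.card (Gen m) / (2 ^ (m + 1)) ^ 2 * ∑ e, ‖L e‖ ^ 2 := by
        rw [Finset.sum_comm]
        simp only [isometry, Finset.sum_const, Finset.card_univ, nsmul_eq_mul]
        ring

lemma sum_norm_sq_aklt (N : ℕ) (L : Qubits m ⊕ Qubits m → ℂ) :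
    ∑ x, ∑ e, ‖aklt N L x e‖ ^ 2 =
      (Fintype.card (Gen m) / (2 ^ (m + 1)) ^ 2 : ℝ) ^ N * ∑ e, ‖L e‖ ^ 2 := by
  induction N generalizing L with
  | zero => simp [aklt_zero]
  | succ N ih =>
    simp only [sum_fin_cons, aklt_succ, ih, ← Finset.mul_sum, sum_norm_sq_nextSpin]
    ring

/-! ### The elementary gates -/

lemma exp_smul_of_mul_self_eq_one {ι : Type*} [Fintype ι] [DecidableEq ι] {A : Matrix ι ι ℂ}
    (hA : A * A = 1) (z : ℂ) :
    NormedSpace.exp (z • A) = Complex.cosh z • 1 + Complex.sinh z • A := by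
  have even_pow (k : ℕ) : A ^ (2 * k) = 1 := by rw [pow_mul, sq, hA, one_pow]
  rw [NormedSpace.exp_eq_tsum ℂ]
  refine HasSum.tsum_eq (HasSum.even_add_odd ?_ ?_)
  · simpa only [smul_pow, even_pow, smul_smul, inv_mul_eq_div] using
      (Complex.hasSum_cosh z).smul_const (1 : Matrix ι ι ℂ)
  · simpa only [smul_pow, pow_succ A, even_pow, one_mul, smul_smul, inv_mul_eq_div] using
      (Complex.hasSum_sinh z).smul_const A

lemma expGate_eq (a : Gen m) (θ : ℝ) :
    expGate a θ = (Real.cos θ : ℂ) • 1 - ((Real.sin θ : ℂ) * Complex.I) • gen a := by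
  rw [expGate, exp_smul_of_mul_self_eq_one (gen_mul_self a), Complex.cosh_neg, Complex.sinh_neg,
    mul_comm Complex.I, Complex.cosh_mul_I, Complex.sinh_mul_I, neg_smul, ← sub_eq_add_neg,
    Complex.ofReal_cos, Complex.ofReal_sin]

lemma expGate_zero (a : Gen m) : expGate a 0 = 1 := by simp [expGate_eq]

lemma expGate_add (a : Gen m) (s t : ℝ) : expGate a (s + t) = expGate a s * expGate a t := by
  rw [expGate, expGate, expGate, ← Matrix.exp_add_of_commute _ _
    (((Commute.refl (gen a)).smul_left _).smul_right _), ← add_smul, Complex.ofReal_add, mul_add,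
    neg_add]

lemma expGate_conjTranspose (a : Gen m) (θ : ℝ) : (expGate a θ)ᴴ = expGate a (-θ) := by
  rw [expGate_eq, expGate_eq, Matrix.conjTranspose_sub, Matrix.conjTranspose_smul,
    Matrix.conjTranspose_smul, gen_conjTranspose, Matrix.conjTranspose_one]
  simp [-Complex.ofReal_cos, -Complex.ofReal_sin]

lemma expGate_mul_pauliOp (a : Gen m) (θ : ℝ) (b : (Fin m → Fin 4) × Fin 4) :
    expGate a θ * pauliOp b = pauliOp b * expGate a (opCommSign a.1 b • θ) := by
  have commutation : gen a * pauliOp b = opCommSign a.1 b • (pauliOp b * gen a) :=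
    pauliOp_mul_comm a.1 b
  rw [expGate_eq, expGate_eq, sub_mul, mul_sub, Matrix.smul_mul, Matrix.smul_mul, Matrix.mul_smul,
    Matrix.mul_smul, one_mul, mul_one, commutation]
  rcases Int.units_eq_one_or (opCommSign a.1 b) with sign | sign <;> simp [sign]

lemma expGate_mem_CSp (a : Gen m) (θ : ℝ) : expGate a θ ∈ CSp (Qubits m) := by
  have unitary : expGate a θ * expGate a (-θ) = 1 := by
    rw [← expGate_add, add_neg_cancel, expGate_zero]
  have J_mul_transpose : Matrix.J (Qubits m) ℂ * (expGate a θ)ᵀ =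
      expGate a (-θ) * Matrix.J (Qubits m) ℂ := by
    rw [expGate_eq, expGate_eq, Matrix.transpose_sub, Matrix.transpose_smul,
      Matrix.transpose_smul, mul_sub, Matrix.mul_smul, Matrix.mul_smul,
      mem_sp_iff.mp (gen_mem_sp a), sub_mul, Matrix.smul_mul, Matrix.smul_mul]
    simp
  exact mem_CSp_iff.mpr (by rw [expGate_conjTranspose]; exact ⟨unitary, J_mul_transpose⟩)

lemma gen_eq_smul_expGate (a : Gen m) : gen a = Complex.I • expGate a (Real.pi / 2) := by
  rw [expGate_eq]
  simp [smul_smul]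

/-! ### Measurement of one site -/

theorem krausOp_rotVec_expGate (a b : Gen m) (θ : ℝ) :
    krausOp (rotVec (expGate a (θ / 2)) b) = (2 ^ (m + 1) : ℂ)⁻¹ •
      if opCommSign a.1 b.1 = -1 then gen b * expGate a θ else gen b := by
  rw [krausOp_rotVec (expGate_mem_CSp a _), expGate_conjTranspose, gen, expGate_mul_pauliOp,
    mul_assoc, ← expGate_add]
  split_ifs with sign
  · simp [sign]
  · simp [(Int.units_eq_one_or _).resolve_right sign, expGate_zero]

lemma trace_gen (a : Gen m) : (gen a).trace = 0 := by
  rw [gen, ← one_mul (pauliOp a.1), ← pauliOp_zero, trace_pauliOp_mul_pauliOp,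
    if_neg a.label_ne_zero.symm]

lemma trace_expGate_mul_gen (a : Gen m) (θ : ℝ) :
    (expGate a θ * gen a).trace = -(Real.sin θ * Complex.I * 2 ^ (m + 1)) := by
  rw [expGate_eq, sub_mul, Matrix.smul_mul, Matrix.smul_mul, one_mul, gen_mul_self,
    Matrix.trace_sub, Matrix.trace_smul, Matrix.trace_smul, trace_gen, Matrix.trace_one,
    card_virtual_cast, smul_zero, zero_sub, smul_eq_mul]

theorem mem_successes_iff {a b : Gen m} {θ : ℝ} (hθ : Real.sin θ ≠ 0) :
    b ∈ successes a θ ↔ opCommSign a.1 b.1 = -1 := by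
  change (∃ c : ℂ, c ≠ 0 ∧ _) ↔ _
  rw [krausOp_rotVec_expGate]
  refine ⟨fun ⟨c, hc, h⟩ => ?_, fun sign => ⟨(2 ^ (m + 1))⁻¹, by simp, by rw [if_pos sign]⟩⟩
  by_contra sign
  have trivial_gate : (2 ^ (m + 1) : ℂ)⁻¹ • 1 = c • expGate a θ := by
    have := congrArg (gen b * ·) h
    simpa only [if_neg sign, Matrix.mul_smul, ← mul_assoc, gen_mul_self, one_mul] using this
  have trace_eq := congrArg (fun A => (A * gen a).trace) trivial_gate
  simp only [Matrix.smul_mul, one_mul, Matrix.trace_smul, trace_gen, trace_expGate_mul_gen,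
    smul_eq_mul] at trace_eq
  simp [-Complex.ofReal_sin, hc, hθ] at trace_eq

theorem gen_anticommute_iff (a b : Gen m) :
    gen a * gen b = -(gen b * gen a) ↔ opCommSign a.1 b.1 = -1 := by
  have isUnit (a : Gen m) : IsUnit (pauliOp a.1) := .of_mul_eq_one _ (gen_mul_self a)
  have ne_zero := ((isUnit b).mul (isUnit a)).ne_zero
  rw [gen, gen, pauliOp_mul_comm, units_int_smul_eq_neg_iff ne_zero]

/-! ### Adaptive measurements -/

/-- The operator on the virtual space that is induced by the outcomes `i`. -/
noncomputable def Rule.op (π : Rule m) {N : ℕ} (i : Fin N → Gen m) :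
    Matrix (Qubits m ⊕ Qubits m) (Qubits m ⊕ Qubits m) ℂ :=
  (List.ofFn fun k => krausOp (π.vecs i k)).reverse.prod

lemma Rule.out_eq (π : Rule m) (L : Qubits m ⊕ Qubits m → ℂ) {N : ℕ} (i : Fin N → Gen m) :
    π.out L i = π.op i *ᵥ L :=
  contract_aklt _ (fun _ => rotVec_mem _ _) L

lemma Rule.op_zero (π : Rule m) (i : Fin 0 → Gen m) : π.op i = 1 := by
  simp [Rule.op]

lemma ofFn_snoc {α : Type*} {N : ℕ} (h : Fin N → α) (b : α) :
    List.ofFn (Fin.snoc h b : Fin (N + 1) → α) = List.ofFn h ++ [b] := by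
  rw [List.ofFn_succ', List.concat_eq_append]
  simp

lemma Rule.op_snoc (π : Rule m) {N : ℕ} (h : Fin N → Gen m) (b : Gen m) :
    π.op (Fin.snoc h b : Fin (N + 1) → Gen m) =
      krausOp (rotVec (π (List.ofFn h)) b) * π.op h := by
  have vecs_last : π.vecs (Fin.snoc h b : Fin (N + 1) → Gen m) (Fin.last N) =
      rotVec (π (List.ofFn h)) b := by
    rw [Rule.vecs, ofFn_snoc, Fin.snoc_last, Fin.val_last, List.take_left' (by simp)]
  have vecs_castSucc (k : Fin N) :
      π.vecs (Fin.snoc h b : Fin (N + 1) → Gen m) k.castSucc = π.vecs h k := by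
    simp only [Rule.vecs, ofFn_snoc, Fin.snoc_castSucc, Fin.val_castSucc]
    rw [List.take_append_of_le_length (by simp)]
  simp only [Rule.op, List.ofFn_succ', List.concat_eq_append, List.reverse_append, vecs_last,
    vecs_castSucc, List.reverse_singleton, List.prod_append, List.prod_singleton]

lemma exists_op_eq_smul {π : Rule m} (hπ : π.IsSymmetric) {N : ℕ} (i : Fin N → Gen m) :
    ∃ (c : ℂ) (S : Matrix (Qubits m ⊕ Qubits m) (Qubits m ⊕ Qubits m) ℂ),
      ‖c‖ = ((2 : ℝ) ^ (m + 1))⁻¹ ^ N ∧ S ∈ CSp (Qubits m) ∧ π.op i = c • S := by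
  induction N with
  | zero => exact ⟨1, 1, by simp, one_mem _, by rw [Rule.op_zero, one_smul]⟩
  | succ N ih =>
    obtain ⟨c, S, hc, hS, h⟩ := ih (Fin.init i)
    have hg : π (List.ofFn (Fin.init i)) ∈ CSp (Qubits m) := hπ _
    refine ⟨(2 ^ (m + 1) : ℂ)⁻¹ * Complex.I * c,
      (π (List.ofFn (Fin.init i)))ᴴ * expGate (i (Fin.last N)) (Real.pi / 2) *
        π (List.ofFn (Fin.init i)) * S, by simp [hc, pow_succ'],
      mul_mem (mul_mem (mul_mem (conjTranspose_mem_CSp hg) (expGate_mem_CSp _ _)) hg) hS, ?_⟩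
    have op_succ := π.op_snoc (Fin.init i) (i (Fin.last N))
    rw [Fin.snoc_init_self, krausOp_rotVec hg, h, gen_eq_smul_expGate] at op_succ
    rw [op_succ]
    simp only [Matrix.mul_smul, Matrix.smul_mul, smul_smul]
    ring_nf

theorem prob_eq {π : Rule m} (hπ : π.IsSymmetric) {N : ℕ} {L : Qubits m ⊕ Qubits m → ℂ}
    (hL : L ≠ 0) (i : Fin N → Gen m) : π.prob L i = (Fintype.card (Gen m) : ℝ)⁻¹ ^ N := by
  obtain ⟨c, S, hc, hS, op_eq⟩ := exists_op_eq_smul hπ i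
  have norm_ne_zero : ∑ e, ‖L e‖ ^ 2 ≠ 0 := fun h => hL <| funext fun e => by
    simpa using (Finset.sum_eq_zero_iff_of_nonneg fun e _ => sq_nonneg ‖L e‖).mp h e
      (Finset.mem_univ e)
  have norm_out : ∑ e, ‖π.out L i e‖ ^ 2 = ‖c‖ ^ 2 * ∑ e, ‖L e‖ ^ 2 := by
    rw [Rule.out_eq, op_eq, Matrix.smul_mulVec,
      ← sum_norm_sq_mulVec (conjTranspose_mul_of_mem_CSp hS) L, Finset.mul_sum]
    simp [mul_pow]
  rw [Rule.prob, norm_out, sum_norm_sq_aklt, mul_div_mul_right _ _ norm_ne_zero, hc, ← pow_mul,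
    mul_comm N 2, pow_mul, ← div_pow, inv_pow, inv_div_left, div_mul_cancel₀ _ (by simp)]

theorem sum_prob_successes {π : Rule m} (hπ : π.IsSymmetric) {N : ℕ} (h : Fin N → Gen m)
    (a : Gen m) {θ : ℝ} (hθ : Real.sin θ ≠ 0) {L : Qubits m ⊕ Qubits m → ℂ} (hL : L ≠ 0) :
    ∑ b : Gen m, Set.indicator (successes a θ)
        (fun b => π.prob L (Fin.snoc h b : Fin (N + 1) → Gen m)) b =
      ((2 ^ m + 1 : ℝ) / (2 * 2 ^ m + 1)) * π.prob L h := by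
  classical
  simp only [Set.indicator_apply, prob_eq hπ hL, mem_successes_iff hθ]
  rw [← Finset.sum_filter, Finset.sum_const, card_anticommuting_gen, nsmul_eq_mul, pow_succ,
    card_gen]
  push_cast
  field_simp

lemma Rule.executes_iff (π : Rule m) {N : ℕ} (i : Fin N → Gen m)
    (V : Matrix (Qubits m ⊕ Qubits m) (Qubits m ⊕ Qubits m) ℂ) :
    π.Executes i V ↔ ∃ (b : (Fin m → Fin 4) × Fin 4) (c : ℂ), c ≠ 0 ∧
      π.op i = c • (pauliOp b * V) := by
  refine exists_congr fun b => exists_congr fun c => and_congr_right fun _ => ?_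
  simp only [Rule.out_eq, ← Matrix.smul_mulVec]
  exact ⟨fun h => Matrix.ext_of_mulVec_single fun k => h _, fun h L => by rw [h]⟩

lemma exists_pauliOp_eq_smul (b : (Fin m → Fin 4) × Fin 4) :
    ∃ (c : ℂ) (S : Matrix (Qubits m ⊕ Qubits m) (Qubits m ⊕ Qubits m) ℂ),
      S ∈ CSp (Qubits m) ∧ pauliOp b = c • S := by
  by_cases hb : b ∈ genLabels m
  · exact ⟨Complex.I, _, expGate_mem_CSp ⟨b, hb⟩ (Real.pi / 2), gen_eq_smul_expGate ⟨b, hb⟩⟩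
  · have sign : sympSign b = 1 :=
      (Int.units_eq_one_or _).resolve_right fun h => hb (mem_genLabels.mpr h)
    refine ⟨1, pauliOp b, mem_CSp_iff.mpr ?_, (one_smul _ _).symm⟩
    rw [pauliOp_conjTranspose, pauliOp_mul_self, J_mul_pauliOp_transpose, sign, one_smul]
    exact ⟨rfl, rfl⟩

open scoped Matrix.Norms.L2Operator in
lemma norm_eq_one_of_smul_mem_unitaryGroup {ι : Type*} [Fintype ι] [DecidableEq ι] [Nonempty ι]
    {w : ℂ} {U : Matrix ι ι ℂ} (hU : U ∈ Matrix.unitaryGroup ι ℂ)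
    (hw : w • U ∈ Matrix.unitaryGroup ι ℂ) : ‖w‖ = 1 := by
  rw [← CStarRing.norm_of_mem_unitary hw, norm_smul, CStarRing.norm_of_mem_unitary hU, mul_one]

theorem exists_phase_of_executes {π : Rule m} (hπ : π.IsSymmetric) {N : ℕ} (i : Fin N → Gen m)
    {V : Matrix (Qubits m ⊕ Qubits m) (Qubits m ⊕ Qubits m) ℂ}
    (hV : V ∈ Matrix.unitaryGroup (Qubits m ⊕ Qubits m) ℂ) (h : π.Executes i V) :
    ∃ z : ℂ, ‖z‖ = 1 ∧ z • V ∈ CSp (Qubits m) := by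
  obtain ⟨b, c, hc, op_eq⟩ := (π.executes_iff i V).mp h
  obtain ⟨c', S, -, hS, op_eq'⟩ := exists_op_eq_smul hπ i
  obtain ⟨c'', S', hS', pauliOp_eq⟩ := exists_pauliOp_eq_smul b
  have V_eq : V = (c⁻¹ * c' * c'') • (S' * S) := by
    calc V = c⁻¹ • (pauliOp b * (c • (pauliOp b * V))) := by
          rw [Matrix.mul_smul, ← mul_assoc, pauliOp_mul_self, one_mul, inv_smul_smul₀ hc]
      _ = (c⁻¹ * c' * c'') • (S' * S) := by
          rw [← op_eq, op_eq', pauliOp_eq, Matrix.mul_smul, Matrix.smul_mul, smul_smul, smul_smul]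
  have hS'S : S' * S ∈ CSp (Qubits m) := mul_mem hS' hS
  rw [V_eq] at hV ⊢
  have norm_eq_one := norm_eq_one_of_smul_mem_unitaryGroup hS'S.1 hV
  refine ⟨(c⁻¹ * c' * c'')⁻¹, by rw [norm_inv, norm_eq_one, inv_one], ?_⟩
  rwa [inv_smul_smul₀ (norm_ne_zero_iff.mp (norm_eq_one ▸ one_ne_zero))]

/-! ### A neighbourhood of the identity consists of products of elementary gates -/

lemma eq_of_sub_star_eq_sub_star {A : Type*} [NormedRing A] [NormedAlgebra ℝ A] [StarRing A]
    {u w : A} (hu : u * star u = 1) (hw : w * star w = 1) (h : u - star u = w - star w)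
    (hu_near : ‖star u - 1‖ < 1) (hw_near : ‖w - 1‖ < 1) : u = w := by
  set d := u - w with hd
  have hu_eq : u = w + d := (add_sub_cancel w u).symm
  have star_hu_eq : star u = star w + d := by
    rw [hd, add_sub, eq_sub_iff_add_eq, add_comm (star w)]
    exact (sub_eq_sub_iff_add_eq_add.mp h.symm).symm ▸ add_comm _ _
  have sylvester : w * d + d * star u = 0 := by
    have expand : 1 = 1 + (w * d + d * star u) := by
      conv_lhs => rw [← hu, hu_eq, add_mul, ← hu_eq, star_hu_eq, mul_add, hw]
      rw [star_hu_eq, add_assoc]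
    exact left_eq_add.mp expand
  have two_smul_eq : (2 : ℝ) • d = -((w - 1) * d + d * (star u - 1)) := by
    rw [two_smul, eq_neg_iff_add_eq_zero, ← sylvester]
    noncomm_ring
  have norm_le : 2 * ‖d‖ ≤ ‖w - 1‖ * ‖d‖ + ‖d‖ * ‖star u - 1‖ := by
    calc 2 * ‖d‖ = ‖(w - 1) * d + d * (star u - 1)‖ := by
          rw [← norm_neg ((w - 1) * d + _), ← two_smul_eq, norm_smul, Real.norm_two]
      _ ≤ ‖(w - 1) * d‖ + ‖d * (star u - 1)‖ := norm_add_le _ _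
      _ ≤ _ := add_le_add (norm_mul_le _ _) (norm_mul_le _ _)
  by_contra hne
  have : 0 < ‖d‖ := norm_pos_iff.mpr (sub_ne_zero.mpr hne)
  nlinarith

/-- Coordinates of the skew-Hermitian part with respect to the matrices `-i N_a`. -/
noncomputable def skewCoord :
    Matrix (Qubits m ⊕ Qubits m) (Qubits m ⊕ Qubits m) ℂ →L[ℝ] (Gen m → ℝ) :=
  LinearMap.toContinuousLinearMap
    { toFun := fun A b => -(gen b * A).trace.im / 2 ^ (m + 1)
      map_add' := fun A B => by
        ext b
        simp only [mul_add, Matrix.trace_add, Complex.add_im, Pi.add_apply]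
        ring
      map_smul' := fun c A => by
        ext b
        simp only [Matrix.mul_smul, Matrix.trace_smul, Complex.smul_im, Pi.smul_apply,
          smul_eq_mul, RingHom.id_apply]
        ring }

lemma skewCoord_apply (A : Matrix (Qubits m ⊕ Qubits m) (Qubits m ⊕ Qubits m) ℂ) (b : Gen m) :
    skewCoord A b = -(gen b * A).trace.im / 2 ^ (m + 1) := rfl

lemma skewCoord_one :
    skewCoord (1 : Matrix (Qubits m ⊕ Qubits m) (Qubits m ⊕ Qubits m) ℂ) = 0 := by
  ext b
  simp [skewCoord_apply, trace_gen]

lemma skewCoord_neg_I_smul_gen (a : Gen m) :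
    skewCoord (-(Complex.I • gen a)) = Pi.single a 1 := by
  ext b
  have re_two_pow : ((2 : ℂ) ^ (m + 1)).re = 2 ^ (m + 1) := by
    rw [← Complex.ofReal_ofNat, ← Complex.ofReal_pow, Complex.ofReal_re]
  rw [skewCoord_apply, mul_neg, Matrix.mul_smul, Matrix.trace_neg, Matrix.trace_smul,
    trace_gen_mul_gen, Pi.single_apply]
  split_ifs <;> simp [re_two_pow]

lemma sub_conjTranspose_mem_sp {l : Type} [Fintype l] [DecidableEq l]
    {U : Matrix (l ⊕ l) (l ⊕ l) ℂ} (hU : U ∈ CSp l) :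
    U - Uᴴ ∈ LieAlgebra.Symplectic.sp l ℂ := by
  have J_mul_transpose := (mem_CSp_iff.mp hU).2
  have J_mul_transpose' := (mem_CSp_iff.mp (conjTranspose_mem_CSp hU)).2
  rw [Matrix.conjTranspose_conjTranspose] at J_mul_transpose'
  rw [mem_sp_iff, Matrix.transpose_sub, mul_sub, J_mul_transpose, J_mul_transpose', sub_mul,
    neg_sub]

lemma trace_gen_mul_sub_conjTranspose (b : Gen m)
    (A : Matrix (Qubits m ⊕ Qubits m) (Qubits m ⊕ Qubits m) ℂ) :
    (gen b * (A - Aᴴ)).trace = 2 * ((gen b * A).trace.im : ℂ) * Complex.I := by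
  have trace_conj : (gen b * Aᴴ).trace = starRingEnd ℂ (gen b * A).trace := by
    rw [starRingEnd_apply, ← Matrix.trace_conjTranspose, Matrix.conjTranspose_mul,
      gen_conjTranspose, Matrix.trace_mul_comm]
  rw [mul_sub, Matrix.trace_sub, trace_conj, Complex.sub_conj]
  push_cast
  rfl

lemma sub_conjTranspose_eq_of_skewCoord_eq
    {U W : Matrix (Qubits m ⊕ Qubits m) (Qubits m ⊕ Qubits m) ℂ} (hU : U ∈ CSp (Qubits m))
    (hW : W ∈ CSp (Qubits m)) (h : skewCoord U = skewCoord W) : U - Uᴴ = W - Wᴴ := by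
  rw [eq_sum_gen (sub_conjTranspose_mem_sp hU), eq_sum_gen (sub_conjTranspose_mem_sp hW)]
  refine Finset.sum_congr rfl fun b _ => ?_
  have coord_eq := congrFun h b
  rw [skewCoord_apply, skewCoord_apply, div_left_inj' (by simp), neg_inj] at coord_eq
  rw [trace_gen_mul_sub_conjTranspose, trace_gen_mul_sub_conjTranspose, coord_eq]

variable (m) in
/-- The monoid generated by the elementary gates. -/
def gateClosure : Submonoid (Matrix (Qubits m ⊕ Qubits m) (Qubits m ⊕ Qubits m) ℂ) :=
  Submonoid.closure {W | ∃ (a : Gen m) (θ : ℝ), W = expGate a θ}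

lemma gateClosure_le : gateClosure m ≤ CSp (Qubits m) := by
  rw [gateClosure, Submonoid.closure_le]
  rintro _ ⟨a, θ, rfl⟩
  exact expGate_mem_CSp a θ

/-- The product of the gates `exp(-i θ_a N_a)` over all generators, in some order. -/
noncomputable def prodGates (θ : Gen m → ℝ) :
    Matrix (Qubits m ⊕ Qubits m) (Qubits m ⊕ Qubits m) ℂ :=
  ((Finset.univ.toList : List (Gen m)).map fun a => expGate a (θ a)).prod

lemma prodGates_zero : prodGates (0 : Gen m → ℝ) = 1 := by
  simp [prodGates, expGate_zero]

lemma prodGates_mem_gateClosure (θ : Gen m → ℝ) : prodGates θ ∈ gateClosure m := by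
  refine list_prod_mem fun W hW => ?_
  obtain ⟨a, -, rfl⟩ := List.mem_map.mp hW
  exact Submonoid.subset_closure ⟨a, θ a, rfl⟩

section InverseFunction

open scoped Matrix.Norms.Operator

lemma hasStrictDerivAt_expGate (a : Gen m) :
    HasStrictDerivAt (expGate a) (-(Complex.I • gen a)) 0 := by
  have expGate_eq_real : expGate a = fun t => Real.cos t • (1 : Matrix _ _ ℂ) -
      Real.sin t • (Complex.I • gen a) := by
    ext1 t
    rw [expGate_eq, ← Complex.coe_smul, ← Complex.coe_smul, smul_smul]
  rw [expGate_eq_real]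
  exact (((Real.hasStrictDerivAt_cos 0).smul_const (1 : Matrix _ _ ℂ)).fun_sub
    ((Real.hasStrictDerivAt_sin 0).smul_const (Complex.I • gen a))).congr_deriv (by simp)

lemma hasStrictFDerivAt_list_prod_of_eq_one {α E A : Type*} [NormedAddCommGroup E]
    [NormedSpace ℝ E] [NormedRing A] [NormedAlgebra ℝ A] {f : α → E → A} {f' : α → E →L[ℝ] A}
    {x : E} (hf : ∀ a, HasStrictFDerivAt (f a) (f' a) x) (eq_one : ∀ a, f a x = 1) (l : List α) :
    HasStrictFDerivAt (fun y => (l.map fun a => f a y).prod) (l.map f').sum x := by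
  induction l with
  | nil => exact hasStrictFDerivAt_const _ _
  | cons a l ih =>
    have prod_eq_one : (l.map fun a => f a x).prod = 1 := by simp [eq_one]
    simp only [List.map_cons, List.prod_cons, List.sum_cons]
    refine ((hf a).mul' ih).congr_fderiv ?_
    rw [prod_eq_one, eq_one, one_smul, MulOpposite.op_one, one_smul, add_comm]

lemma hasStrictFDerivAt_prodGates :
    HasStrictFDerivAt (prodGates (m := m))
      (∑ a, (ContinuousLinearMap.proj (R := ℝ) (φ := fun _ : Gen m => ℝ) a).smulRight
        (-(Complex.I • gen a))) 0 := by
  rw [← Finset.sum_map_toList]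
  refine hasStrictFDerivAt_list_prod_of_eq_one
    (f := fun a (θ : Gen m → ℝ) => expGate a (θ a)) (fun a => ?_) expGate_zero _
  exact (hasStrictDerivAt_expGate a).hasStrictFDerivAt.comp (0 : Gen m → ℝ)
    (ContinuousLinearMap.proj (R := ℝ) (φ := fun _ : Gen m => ℝ) a).hasStrictFDerivAt

lemma hasStrictFDerivAt_skewCoord_prodGates :
    HasStrictFDerivAt (fun θ : Gen m → ℝ => skewCoord (prodGates θ))
      (ContinuousLinearMap.id ℝ (Gen m → ℝ)) 0 := by
  refine (skewCoord.hasStrictFDerivAt.comp _ hasStrictFDerivAt_prodGates).congr_fderiv ?_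
  ext1 v
  have deriv_apply : (∑ a, (ContinuousLinearMap.proj (R := ℝ) (φ := fun _ : Gen m => ℝ)
      a).smulRight (-(Complex.I • gen a))) v = ∑ a, v a • -(Complex.I • gen a) := by
    simp only [_root_.sum_apply, ContinuousLinearMap.smulRight_apply,
      ContinuousLinearMap.proj_apply]
  refine (congrArg skewCoord deriv_apply).trans ?_
  simp only [map_sum, map_smul, skewCoord_neg_I_smul_gen]
  exact (pi_eq_sum_univ' v).symm

lemma eventually_mem_gateClosure :
    ∀ᶠ U in 𝓝 (1 : Matrix (Qubits m ⊕ Qubits m) (Qubits m ⊕ Qubits m) ℂ),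
      U ∈ CSp (Qubits m) → U ∈ gateClosure m := by
  have prodGates_near : ∀ᶠ θ in 𝓝 (0 : Gen m → ℝ), ‖prodGates θ - 1‖ < 1 := by
    have continuousAt := (hasStrictFDerivAt_prodGates (m := m)).continuousAt
    rw [ContinuousAt, prodGates_zero] at continuousAt
    simpa only [Metric.mem_ball, dist_eq_norm]
      using continuousAt.eventually (Metric.ball_mem_nhds 1 one_pos)
  have image_mem : (fun θ => skewCoord (prodGates θ)) '' {θ | ‖prodGates θ - 1‖ < 1} ∈
      𝓝 (0 : Gen m → ℝ) := by
    have map_nhds := (hasStrictFDerivAt_skewCoord_prodGates (m := m)).map_nhds_eq_of_surj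
      (LinearMap.range_id)
    rw [prodGates_zero, skewCoord_one] at map_nhds
    exact map_nhds ▸ image_mem_map prodGates_near
  have conjTranspose_near : ∀ᶠ U in 𝓝 (1 : Matrix (Qubits m ⊕ Qubits m) (Qubits m ⊕ Qubits m) ℂ),
      ‖Uᴴ - 1‖ < 1 := by
    have tendsto := (continuous_id.matrix_conjTranspose (A := fun U => U)).tendsto
      (1 : Matrix (Qubits m ⊕ Qubits m) (Qubits m ⊕ Qubits m) ℂ)
    rw [Matrix.conjTranspose_one] at tendsto
    simpa only [Metric.mem_ball, dist_eq_norm]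
      using tendsto.eventually (Metric.ball_mem_nhds 1 one_pos)
  filter_upwards [conjTranspose_near, (skewCoord.continuous.tendsto' 1 0 skewCoord_one) image_mem]
    with U hU_near ⟨θ, hθ_near, skewCoord_eq⟩ hU
  have hθ : prodGates θ ∈ CSp (Qubits m) := gateClosure_le (prodGates_mem_gateClosure θ)
  have U_eq : U = prodGates θ := eq_of_sub_star_eq_sub_star (mul_conjTranspose_of_mem_CSp hU)
    (mul_conjTranspose_of_mem_CSp hθ)
    (sub_conjTranspose_eq_of_skewCoord_eq hU hθ skewCoord_eq.symm) hU_near hθ_near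
  exact U_eq ▸ prodGates_mem_gateClosure θ

end InverseFunction

lemma mem_gateClosure_of_continuous_add
    {R : ℝ → Matrix (Qubits m ⊕ Qubits m) (Qubits m ⊕ Qubits m) ℂ}
    (hR : Continuous R) (zero : R 0 = 1) (add : ∀ s t, R (s + t) = R s * R t)
    (mem : ∀ t, R t ∈ CSp (Qubits m)) (t : ℝ) : R t ∈ gateClosure m := by
  have tendsto_one : Tendsto (fun k : ℕ => R (t / ((k : ℝ) + 1))) atTop (𝓝 1) := by
    refine (hR.tendsto' 0 1 zero).comp ?_
    simpa [div_eq_mul_inv] using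
      (tendsto_one_div_add_atTop_nhds_zero_nat (𝕜 := ℝ)).const_mul t
  obtain ⟨k, hk⟩ := (tendsto_one.eventually eventually_mem_gateClosure).exists
  have natCast_mul (j : ℕ) (s : ℝ) : R (j * s) = R s ^ j := by
    induction j with
    | zero => simp [zero]
    | succ j ih => rw [pow_succ, ← ih, ← add, Nat.cast_succ, add_one_mul]
  have t_eq : t = (k + 1 : ℕ) * (t / ((k : ℝ) + 1)) := by
    push_cast
    field_simp
  rw [t_eq, natCast_mul]
  exact pow_mem (hk (mem _)) _

/-! ### Every symplectic unitary is a product of rotations of a line and its conjugate -/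

section Rotation

variable {l : Type} [Fintype l] [DecidableEq l] {P : Matrix (l ⊕ l) (l ⊕ l) ℂ}

/-- The projection onto the quaternionic conjugate of the range of a projection `P`: the
antiunitary structure map `x ↦ J * star x` commutes with `CSp l` and carries one range to the
other. -/
def conjProj (P : Matrix (l ⊕ l) (l ⊕ l) ℂ) : Matrix (l ⊕ l) (l ⊕ l) ℂ :=
  -(Matrix.J l ℂ * Pᵀ * Matrix.J l ℂ)

/-- The rotation by the phase `exp (i t)` on the range of `P` and `exp (-i t)` on its quaternionic
conjugate. -/
noncomputable def symplRot (P : Matrix (l ⊕ l) (l ⊕ l) ℂ) (t : ℝ) : Matrix (l ⊕ l) (l ⊕ l) ℂ :=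
  1 + (Complex.exp (t * Complex.I) - 1) • P + (Complex.exp (-(t * Complex.I)) - 1) • conjProj P

lemma conjProj_mul_self (hP : P * P = P) : conjProj P * conjProj P = conjProj P := by
  have transpose_mul_self : Pᵀ * Pᵀ = Pᵀ := by rw [← Matrix.transpose_mul, hP]
  rw [conjProj, neg_mul_neg]
  simp only [mul_assoc, J_mul_J_mul, mul_neg]
  rw [← mul_assoc Pᵀ Pᵀ, transpose_mul_self]

lemma conjProj_conjTranspose (hP : Pᴴ = P) : (conjProj P)ᴴ = conjProj P := by
  have conjTranspose_transpose : (Pᵀ)ᴴ = Pᵀ := congrArg Matrix.transpose hP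
  rw [conjProj, Matrix.conjTranspose_neg, Matrix.conjTranspose_mul, Matrix.conjTranspose_mul,
    conjTranspose_transpose, J_conjTranspose, neg_mul, mul_neg, mul_neg, neg_neg, mul_assoc]

lemma J_mul_transpose_eq_conjProj_mul : Matrix.J l ℂ * Pᵀ = conjProj P * Matrix.J l ℂ := by
  rw [conjProj, neg_mul, mul_assoc, mul_assoc, Matrix.J_squared, mul_neg, mul_neg, mul_one,
    neg_neg]

lemma conjProj_conjProj : conjProj (conjProj P) = P := by
  simp only [conjProj, Matrix.transpose_neg, Matrix.transpose_mul, Matrix.transpose_transpose,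
    Matrix.J_transpose, mul_assoc, neg_mul, mul_neg, neg_neg, J_mul_J_mul, Matrix.J_squared,
    mul_one]

lemma mul_conjProj (hPJ : P * Matrix.J l ℂ * Pᵀ = 0) : P * conjProj P = 0 := by
  rw [conjProj, mul_neg, ← mul_assoc, ← mul_assoc, hPJ, zero_mul, neg_zero]

lemma conjProj_mul (hP : Pᴴ = P) (hPJ : P * Matrix.J l ℂ * Pᵀ = 0) : conjProj P * P = 0 := by
  have conjTranspose_eq := congrArg Matrix.conjTranspose (mul_conjProj hPJ)
  rwa [Matrix.conjTranspose_mul, conjProj_conjTranspose hP, hP,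
    Matrix.conjTranspose_zero] at conjTranspose_eq

lemma symplRot_zero : symplRot P 0 = 1 := by simp [symplRot]

lemma symplRot_add (hP : IsStarProjection P) (hPJ : P * Matrix.J l ℂ * Pᵀ = 0) (s t : ℝ) :
    symplRot P (s + t) = symplRot P s * symplRot P t := by
  have mul_self : P * P = P := hP.isIdempotentElem
  simp only [symplRot, mul_add, add_mul, one_mul, mul_one, Matrix.smul_mul, Matrix.mul_smul,
    mul_self, conjProj_mul_self mul_self, mul_conjProj hPJ, conjProj_mul hP.isSelfAdjoint hPJ,
    smul_zero, add_zero, Complex.ofReal_add, neg_add, Complex.exp_add, smul_smul]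
  module

lemma continuous_symplRot : Continuous (symplRot P) := by
  unfold symplRot
  fun_prop

lemma symplRot_conjTranspose (hP : Pᴴ = P) (t : ℝ) : (symplRot P t)ᴴ = symplRot P (-t) := by
  have star_exp (z : ℂ) : star (Complex.exp z) = Complex.exp (star z) := (Complex.exp_conj z).symm
  simp [symplRot, Matrix.conjTranspose_add, Matrix.conjTranspose_smul, hP,
    conjProj_conjTranspose hP, star_exp]

lemma symplRot_mem_CSp (hP : IsStarProjection P) (hPJ : P * Matrix.J l ℂ * Pᵀ = 0) (t : ℝ) :
    symplRot P t ∈ CSp l := by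
  refine mem_CSp_iff.mpr ⟨?_, ?_⟩
  · rw [symplRot_conjTranspose hP.isSelfAdjoint, ← symplRot_add hP hPJ, add_neg_cancel,
      symplRot_zero]
  · rw [symplRot_conjTranspose hP.isSelfAdjoint]
    simp only [symplRot, Matrix.transpose_add, Matrix.transpose_smul, Matrix.transpose_one,
      mul_add, add_mul, Matrix.mul_smul, Matrix.smul_mul, J_mul_transpose_eq_conjProj_mul,
      conjProj_conjProj, mul_one, one_mul, Complex.ofReal_neg, neg_mul, neg_neg]
    abel

end Rotation

section Line

variable {ι : Type*} [Fintype ι]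

/-- The orthogonal projection onto the line spanned by a nonzero vector `v`. -/
noncomputable def lineProj (v : ι → ℂ) : Matrix ι ι ℂ :=
  (star v ⬝ᵥ v)⁻¹ • Matrix.vecMulVec v (star v)

open scoped ComplexOrder in
lemma isStarProjection_lineProj (v : ι → ℂ) : IsStarProjection (lineProj v) where
  isIdempotentElem := by
    obtain rfl | hv := eq_or_ne v 0
    · simp [lineProj, IsIdempotentElem]
    have norm_ne_zero : star v ⬝ᵥ v ≠ 0 := dotProduct_star_self_eq_zero.not.mpr hv
    rw [IsIdempotentElem, lineProj, Matrix.smul_mul, Matrix.mul_smul,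
      Matrix.vecMulVec_mul_vecMulVec, Matrix.vecMulVec_smul,
      smul_smul (star v ⬝ᵥ v)⁻¹ (star v ⬝ᵥ v), inv_mul_cancel₀ norm_ne_zero, one_smul]
  isSelfAdjoint := by
    change (lineProj v)ᴴ = lineProj v
    rw [lineProj, Matrix.conjTranspose_smul, Matrix.conjTranspose_vecMulVec, star_star, star_inv₀,
      ← Matrix.star_dotProduct]

lemma lineProj_mulVec (v x : ι → ℂ) :
    lineProj v *ᵥ x = ((star v ⬝ᵥ v)⁻¹ * (star v ⬝ᵥ x)) • v := by
  rw [lineProj, Matrix.smul_mulVec, Matrix.vecMulVec_mulVec, ← smul_smul, op_smul_eq_smul]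

variable {l : Type} [Fintype l] [DecidableEq l]

lemma dotProduct_J_mulVec_self (v : l ⊕ l → ℂ) : v ⬝ᵥ (Matrix.J l ℂ *ᵥ v) = 0 := by
  refine self_eq_neg.mp ?_
  conv_lhs => rw [Matrix.dotProduct_mulVec, ← Matrix.mulVec_transpose, Matrix.J_transpose,
    Matrix.neg_mulVec, neg_dotProduct, dotProduct_comm]

lemma lineProj_mul_J_mul_transpose (v : l ⊕ l → ℂ) :
    lineProj v * Matrix.J l ℂ * (lineProj v)ᵀ = 0 := by
  rw [lineProj, Matrix.transpose_smul, Matrix.transpose_vecMulVec, Matrix.smul_mul,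
    Matrix.smul_mul, Matrix.mul_smul, mul_assoc, Matrix.mul_vecMulVec,
    Matrix.vecMulVec_mul_vecMulVec]
  simp [dotProduct_J_mulVec_self]

lemma conjProj_lineProj_mulVec {v x : l ⊕ l → ℂ} (h : v ⬝ᵥ (Matrix.J l ℂ *ᵥ x) = 0) :
    conjProj (lineProj v) *ᵥ x = 0 := by
  rw [conjProj, lineProj, Matrix.transpose_smul, Matrix.transpose_vecMulVec, Matrix.neg_mulVec,
    ← Matrix.mulVec_mulVec, ← Matrix.mulVec_mulVec, Matrix.smul_mulVec, Matrix.vecMulVec_mulVec, h]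
  simp

lemma symplRot_lineProj_mulVec_of_orthogonal {v x : l ⊕ l → ℂ} (h : star v ⬝ᵥ x = 0)
    (hJ : v ⬝ᵥ (Matrix.J l ℂ *ᵥ x) = 0) (t : ℝ) : symplRot (lineProj v) t *ᵥ x = x := by
  rw [symplRot, Matrix.add_mulVec, Matrix.add_mulVec, Matrix.smul_mulVec, Matrix.smul_mulVec,
    conjProj_lineProj_mulVec hJ, lineProj_mulVec, h]
  simp

open scoped ComplexOrder in
lemma symplRot_lineProj_mulVec_self (v : l ⊕ l → ℂ) (t : ℝ) :
    symplRot (lineProj v) t *ᵥ v = Complex.exp (t * Complex.I) • v := by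
  obtain rfl | hv := eq_or_ne v 0
  · simp
  have norm_ne_zero : star v ⬝ᵥ v ≠ 0 := dotProduct_star_self_eq_zero.not.mpr hv
  rw [symplRot, Matrix.add_mulVec, Matrix.add_mulVec, Matrix.smul_mulVec, Matrix.smul_mulVec,
    conjProj_lineProj_mulVec (dotProduct_J_mulVec_self v), lineProj_mulVec,
    inv_mul_cancel₀ norm_ne_zero, Matrix.one_mulVec]
  module

end Line

section FixedSpace

variable {ι : Type*} [Fintype ι] {U : Matrix ι ι ℂ}

open scoped ComplexOrder

/-- The space of vectors fixed by a matrix. -/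
def fixedSpace (U : Matrix ι ι ℂ) : Submodule ℂ (ι → ℂ) :=
  Module.End.eigenspace U.mulVecLin 1

lemma mem_fixedSpace {x : ι → ℂ} : x ∈ fixedSpace U ↔ U *ᵥ x = x := by
  rw [fixedSpace, Module.End.mem_eigenspace_iff, Matrix.mulVecLin_apply, one_smul]

variable [DecidableEq ι]

lemma eq_one_of_fixedSpace_eq_top (h : fixedSpace U = ⊤) : U = 1 :=
  Matrix.ext_of_mulVec_single fun i => by
    rw [Matrix.one_mulVec]
    exact mem_fixedSpace.mp (h ▸ Submodule.mem_top)

lemma star_dotProduct_eq_zero_of_mem_fixedSpace (hU : Uᴴ * U = 1) {z : ℂ} (hz : z ≠ 1)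
    {v x : ι → ℂ} (hv : U *ᵥ v = z • v) (hx : x ∈ fixedSpace U) : star v ⬝ᵥ x = 0 := by
  have invariance := star_mulVec_dotProduct_mulVec hU v x
  rw [hv, mem_fixedSpace.mp hx, star_smul, smul_dotProduct, smul_eq_mul] at invariance
  exact (mul_left_eq_self₀.mp invariance).resolve_left fun h =>
    hz (star_injective (h.trans (_root_.star_one ℂ).symm))

lemma norm_eq_one_of_mulVec_eq_smul (hU : Uᴴ * U = 1) {z : ℂ} {v : ι → ℂ} (v_ne_zero : v ≠ 0)
    (hv : U *ᵥ v = z • v) : ‖z‖ = 1 := by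
  have invariance := star_mulVec_dotProduct_mulVec hU v v
  rw [hv, star_smul, smul_dotProduct, dotProduct_smul, smul_smul, smul_eq_mul] at invariance
  have star_mul_self : star z * z = 1 :=
    (mul_left_eq_self₀.mp invariance).resolve_right (dotProduct_star_self_eq_zero.not.mpr v_ne_zero)
  exact CStarRing.norm_of_mem_unitary (Unitary.mem_iff.mpr ⟨star_mul_self, by
    rwa [mul_comm] at star_mul_self⟩)

lemma mulVec_sub_self_eq_zero_of_mem_fixedSpace (hU : Uᴴ * U = 1) {w : ι → ℂ}
    (h : U *ᵥ w - w ∈ fixedSpace U) : U *ᵥ w - w = 0 := by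
  set v := U *ᵥ w - w with hv
  have invariance := star_mulVec_dotProduct_mulVec hU v w
  rw [mem_fixedSpace.mp h, ← sub_eq_zero, ← dotProduct_sub, ← hv] at invariance
  exact dotProduct_star_self_eq_zero.mp invariance

lemma exists_eigenvector_ne_one (hU : Uᴴ * U = 1) (hne : U ≠ 1) :
    ∃ (z : ℂ) (v : ι → ℂ), v ≠ 0 ∧ z ≠ 1 ∧ U *ᵥ v = z • v := by
  set E := LinearMap.range (U.mulVecLin - 1) with hE
  have invariant : ∀ x ∈ E, U.mulVecLin x ∈ E := by
    rintro _ ⟨w, rfl⟩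
    exact ⟨U *ᵥ w, by simp [Matrix.mulVec_sub]⟩
  have nontrivial : Nontrivial E := by
    rw [Submodule.nontrivial_iff_ne_bot, hE, Ne, LinearMap.range_eq_bot, sub_eq_zero]
    exact fun h => hne (eq_one_of_fixedSpace_eq_top (by
      rw [fixedSpace, h, Module.End.eigenspace_def]
      simp))
  obtain ⟨z, hz⟩ := Module.End.exists_eigenvalue (U.mulVecLin.restrict invariant)
  obtain ⟨⟨v, w, hw⟩, eigenvector⟩ := hz.exists_hasEigenvector
  have v_ne_zero : v ≠ 0 := fun h => eigenvector.2 (Subtype.ext h)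
  have hv : U *ᵥ v = z • v := congrArg Subtype.val eigenvector.apply_eq_smul
  refine ⟨z, v, v_ne_zero, ?_, hv⟩
  rintro rfl
  rw [one_smul, ← mem_fixedSpace] at hv
  subst hw
  exact v_ne_zero (mulVec_sub_self_eq_zero_of_mem_fixedSpace hU hv)

end FixedSpace

section Generation

variable {l : Type} [Fintype l] [DecidableEq l] {U : Matrix (l ⊕ l) (l ⊕ l) ℂ}

lemma dotProduct_J_mulVec_of_mem_CSp (hU : U ∈ CSp l) (x y : l ⊕ l → ℂ) :
    (U *ᵥ x) ⬝ᵥ (Matrix.J l ℂ *ᵥ (U *ᵥ y)) = x ⬝ᵥ (Matrix.J l ℂ *ᵥ y) := by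
  have transpose_mul_J_mul : Uᵀ * (Matrix.J l ℂ * U) = Matrix.J l ℂ := by
    have transpose_eq : Uᵀ = -(Matrix.J l ℂ * (Uᴴ * Matrix.J l ℂ)) := by
      rw [← (mem_CSp_iff.mp hU).2, J_mul_J_mul, neg_neg]
    rw [transpose_eq, neg_mul, mul_assoc, mul_assoc, J_mul_J_mul, mul_neg,
      conjTranspose_mul_of_mem_CSp hU, mul_neg, mul_one, neg_neg]
  rw [Matrix.mulVec_mulVec, Matrix.dotProduct_mulVec, ← Matrix.vecMul_transpose,
    Matrix.vecMul_vecMul, transpose_mul_J_mul, Matrix.dotProduct_mulVec]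

lemma dotProduct_J_mulVec_eq_zero_of_mem_fixedSpace (hU : U ∈ CSp l) {z : ℂ} (hz : z ≠ 1)
    {v x : l ⊕ l → ℂ} (hv : U *ᵥ v = z • v) (hx : x ∈ fixedSpace U) :
    v ⬝ᵥ (Matrix.J l ℂ *ᵥ x) = 0 := by
  have invariance := dotProduct_J_mulVec_of_mem_CSp hU v x
  rw [hv, mem_fixedSpace.mp hx, smul_dotProduct, smul_eq_mul] at invariance
  exact (mul_left_eq_self₀.mp invariance).resolve_left hz

lemma exists_fixedSpace_lt_fixedSpace_symplRot_mul (hU : U ∈ CSp l) (hne : U ≠ 1) :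
    ∃ (v : l ⊕ l → ℂ) (t : ℝ), fixedSpace U < fixedSpace (symplRot (lineProj v) t * U) := by
  have unitary := conjTranspose_mul_of_mem_CSp hU
  obtain ⟨z, v, v_ne_zero, hz, hv⟩ := exists_eigenvector_ne_one unitary hne
  have exp_arg : Complex.exp (z.arg * Complex.I) = z := by
    have polar := Complex.norm_mul_exp_arg_mul_I z
    rwa [norm_eq_one_of_mulVec_eq_smul unitary v_ne_zero hv, Complex.ofReal_one, one_mul] at polar
  refine ⟨v, -z.arg, SetLike.lt_iff_le_and_exists.mpr ⟨fun x hx => ?_, v, ?_, fun h => ?_⟩⟩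
  · rw [mem_fixedSpace, ← Matrix.mulVec_mulVec, mem_fixedSpace.mp hx]
    exact symplRot_lineProj_mulVec_of_orthogonal
      (star_dotProduct_eq_zero_of_mem_fixedSpace unitary hz hv hx)
      (dotProduct_J_mulVec_eq_zero_of_mem_fixedSpace hU hz hv hx) _
  · nth_rewrite 1 [← exp_arg] at hv
    rw [mem_fixedSpace, ← Matrix.mulVec_mulVec, hv, Matrix.mulVec_smul,
      symplRot_lineProj_mulVec_self, smul_smul, ← Complex.exp_add]
    simp
  · rw [mem_fixedSpace, hv] at h
    exact hz (smul_left_injective ℂ v_ne_zero (h.trans (one_smul ℂ v).symm))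

end Generation

lemma symplRot_lineProj_mem_gateClosure (v : Qubits m ⊕ Qubits m → ℂ) (t : ℝ) :
    symplRot (lineProj v) t ∈ gateClosure m :=
  mem_gateClosure_of_continuous_add continuous_symplRot symplRot_zero
    (symplRot_add (isStarProjection_lineProj v) (lineProj_mul_J_mul_transpose v))
    (symplRot_mem_CSp (isStarProjection_lineProj v) (lineProj_mul_J_mul_transpose v)) t

lemma mem_gateClosure_of_mem_CSp {U : Matrix (Qubits m ⊕ Qubits m) (Qubits m ⊕ Qubits m) ℂ}
    (hU : U ∈ CSp (Qubits m)) : U ∈ gateClosure m := by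
  induction h : fixedSpace U using WellFoundedGT.induction generalizing U with
  | _ F ih =>
    subst h
    by_cases hne : U = 1
    · exact hne ▸ one_mem _
    obtain ⟨v, t, fixedSpace_lt⟩ := exists_fixedSpace_lt_fixedSpace_symplRot_mul hU hne
    have rot_mem (t : ℝ) := symplRot_lineProj_mem_gateClosure v t
    have U_eq : U = symplRot (lineProj v) (-t) * (symplRot (lineProj v) t * U) := by
      rw [← mul_assoc, ← symplRot_add (isStarProjection_lineProj v)
        (lineProj_mul_J_mul_transpose v), neg_add_cancel, symplRot_zero, one_mul]
    rw [U_eq]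
    exact mul_mem (rot_mem _)
      (ih _ fixedSpace_lt (mul_mem (gateClosure_le (rot_mem t)) hU) rfl)

theorem gateClosure_eq : gateClosure m = CSp (Qubits m) :=
  le_antisymm gateClosure_le fun _ => mem_gateClosure_of_mem_CSp

/-! ### An adaptive rule that executes a given gate -/

/-- The product of a list of elementary gates, the first one in the list acting first. -/
noncomputable def gateProd (gs : List (Gen m × ℝ)) :
    Matrix (Qubits m ⊕ Qubits m) (Qubits m ⊕ Qubits m) ℂ :=
  (gs.map fun g => expGate g.1 g.2).reverse.prod

lemma gateProd_cons (g : Gen m × ℝ) (gs : List (Gen m × ℝ)) :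
    gateProd (g :: gs) = gateProd gs * expGate g.1 g.2 := by
  simp [gateProd]

lemma exists_gateProd_eq {V : Matrix (Qubits m ⊕ Qubits m) (Qubits m ⊕ Qubits m) ℂ}
    (hV : V ∈ gateClosure m) : ∃ gs : List (Gen m × ℝ), V = gateProd gs := by
  induction hV using Submonoid.closure_induction_right with
  | one => exact ⟨[], by simp [gateProd]⟩
  | mul_right x _ y hy ih =>
    obtain ⟨gs, rfl⟩ := ih
    obtain ⟨a, θ, rfl⟩ := hy
    exact ⟨(a, θ) :: gs, (gateProd_cons (a, θ) gs).symm⟩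

instance : Nonempty (Gen m) := by
  rw [← Fintype.card_pos_iff, card_gen]
  positivity

/-- The gate to be executed next; a trivial gate once the list is exhausted. -/
noncomputable def nextGate (gs : List (Gen m × ℝ)) : Gen m × ℝ :=
  gs.headD (Classical.arbitrary _, 0)

lemma gateProd_tail_mul (gs : List (Gen m × ℝ)) :
    gateProd gs.tail * expGate (nextGate gs).1 (nextGate gs).2 = gateProd gs := by
  cases gs with
  | nil => rw [List.tail_nil, nextGate, List.headD_nil, expGate_zero, mul_one]
  | cons g gs => exact (gateProd_cons g gs).symm

/-- The gates still to be executed, and the label of the byproduct operator so far. -/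
abbrev Progress (m : ℕ) : Type := List (Gen m × ℝ) × ((Fin m → Fin 4) × Fin 4)

/-- The update of the progress by the next outcome. -/
noncomputable def Progress.step (st : Progress m) (b : Gen m) : Progress m :=
  (if opCommSign (nextGate st.1).1.1 b.1 = -1 then st.1.tail else st.1, mulLabel b.1 st.2)

/-- The rotation of the next basis. -/
noncomputable def Progress.rot (st : Progress m) :
    Matrix (Qubits m ⊕ Qubits m) (Qubits m ⊕ Qubits m) ℂ :=
  -- The sign compensates for moving the gate through the byproduct operator.
  expGate (nextGate st.1).1 (opCommSign (nextGate st.1).1.1 st.2 • (nextGate st.1).2 / 2)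

/-- The progress after given outcomes. -/
noncomputable def progress (gs : List (Gen m × ℝ)) (h : List (Gen m)) : Progress m :=
  h.foldl Progress.step (gs, 0)

/-- The adaptive rule that executes a list of gates, repeating each one until success. -/
noncomputable def gateRule (gs : List (Gen m × ℝ)) : Rule m := fun h => (progress gs h).rot

lemma gateRule_isElementary (gs : List (Gen m × ℝ)) : (gateRule gs).IsElementary :=
  fun _ => ⟨_, _, rfl⟩

lemma Rule.IsElementary.isSymmetric {π : Rule m} (hπ : π.IsElementary) : π.IsSymmetric := by
  intro h
  obtain ⟨a, θ, rotation_eq⟩ := hπ h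
  exact rotation_eq ▸ expGate_mem_CSp a θ

lemma krausOp_rot_mul_pauliOp (st : Progress m) (b : Gen m) :
    ∃ (c : ℂ) (E : Matrix (Qubits m ⊕ Qubits m) (Qubits m ⊕ Qubits m) ℂ), c ≠ 0 ∧
      krausOp (rotVec st.rot b) * pauliOp st.2 = c • (pauliOp (st.step b).2 * E) ∧
      gateProd (st.step b).1 * E = gateProd st.1 := by
  obtain ⟨c, hc, gen_mul⟩ := exists_pauliOp_mul_eq_smul b.1 st.2
  have scalar_ne_zero : (2 ^ (m + 1) : ℂ)⁻¹ * c ≠ 0 := mul_ne_zero (by simp) hc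
  rw [Progress.rot, krausOp_rotVec_expGate, Progress.step]
  split_ifs with success
  · refine ⟨_, _, scalar_ne_zero, ?_, gateProd_tail_mul st.1⟩
    rw [Matrix.smul_mul, mul_assoc, expGate_mul_pauliOp, smul_smul, Int.units_mul_self, one_smul,
      gen, ← mul_assoc, gen_mul, Matrix.smul_mul, smul_smul]
  · refine ⟨_, 1, scalar_ne_zero, ?_, mul_one _⟩
    rw [Matrix.smul_mul, gen, gen_mul, smul_smul, mul_one]

lemma exists_gateRule_op_eq (gs : List (Gen m × ℝ)) {N : ℕ} (i : Fin N → Gen m) :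
    ∃ (c : ℂ) (D : Matrix (Qubits m ⊕ Qubits m) (Qubits m ⊕ Qubits m) ℂ), c ≠ 0 ∧
      (gateRule gs).op i = c • (pauliOp (progress gs (List.ofFn i)).2 * D) ∧
      gateProd (progress gs (List.ofFn i)).1 * D = gateProd gs := by
  induction N with
  | zero =>
    refine ⟨1, 1, one_ne_zero, ?_, by rw [mul_one]; rfl⟩
    rw [Rule.op_zero, List.ofFn_zero, progress, List.foldl_nil, pauliOp_zero, one_smul, mul_one]
  | succ N ih =>
    obtain ⟨h, b, rfl⟩ : ∃ (h : Fin N → Gen m) (b : Gen m), i = Fin.snoc h b :=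
      ⟨Fin.init i, i (Fin.last N), (Fin.snoc_init_self i).symm⟩
    obtain ⟨c, D, hc, op_eq, hD⟩ := ih h
    obtain ⟨c', E, hc', kraus_eq, hE⟩ := krausOp_rot_mul_pauliOp (progress gs (List.ofFn h)) b
    have progress_snoc : progress gs (List.ofFn (Fin.snoc h b : Fin (N + 1) → Gen m)) =
        (progress gs (List.ofFn h)).step b := by
      rw [ofFn_snoc, progress, List.foldl_append]
      rfl
    refine ⟨c * c', E * D, mul_ne_zero hc hc', ?_, ?_⟩
    · rw [progress_snoc, Rule.op_snoc, op_eq, gateRule, Matrix.mul_smul, ← mul_assoc, kraus_eq,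
        Matrix.smul_mul, smul_smul, mul_assoc]
    · rw [progress_snoc, ← mul_assoc, hE, hD]

/-! ### The rule succeeds with probability tending to one -/

/-- A potential that vanishes exactly when all gates have been executed and that shrinks in the
mean by a constant factor with every outcome. -/
noncomputable def Progress.weight (st : Progress m) : ℝ := 2 ^ st.1.length - 1

variable (m) in
/-- A bound for the factor by which the total weight grows when a site is added. -/
noncomputable def growth : ℝ := Fintype.card (Gen m) - 2 ^ m * (2 ^ m + 1) / 2

lemma growth_nonneg : 0 ≤ growth m := by
  rw [growth, card_gen]
  push_cast
  nlinarith [pow_pos (two_pos (α := ℝ)) m]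

lemma growth_lt_card : growth m < Fintype.card (Gen m) :=
  sub_lt_self _ (by positivity)

lemma Progress.weight_nonneg (st : Progress m) : 0 ≤ st.weight :=
  sub_nonneg.mpr (one_le_pow₀ one_le_two)

lemma sum_weight_step (st : Progress m) : ∑ b, (st.step b).weight ≤ growth m * st.weight := by
  obtain ⟨_ | ⟨g, gs⟩, B⟩ := st
  · simp [Progress.step, Progress.weight]
  have weight_step (b : Gen m) : (Progress.step (g :: gs, B) b).weight =
      (2 ^ (gs.length + 1) - 1) - if opCommSign g.1.1 b.1 = -1 then 2 ^ gs.length else 0 := by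
    rw [Progress.weight, Progress.step, apply_ite List.length, nextGate, List.headD_cons]
    split_ifs
    · rw [List.tail_cons, pow_succ]
      ring
    · rw [List.length_cons, sub_zero]
  simp only [weight_step]
  rw [Finset.sum_sub_distrib, ← Finset.sum_filter, Finset.sum_const, Finset.sum_const,
    card_anticommuting_gen, Finset.card_univ]
  simp only [nsmul_eq_mul, Progress.weight, List.length_cons, growth, pow_succ]
  push_cast
  nlinarith [pow_pos (two_pos (α := ℝ)) m]

lemma sum_weight_foldl_step (N : ℕ) (st : Progress m) :
    ∑ i : Fin N → Gen m, ((List.ofFn i).foldl Progress.step st).weight ≤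
      growth m ^ N * st.weight := by
  induction N generalizing st with
  | zero => simp
  | succ N ih =>
    rw [sum_fin_cons]
    simp only [List.ofFn_cons, List.foldl_cons]
    calc _ ≤ ∑ b, growth m ^ N * (st.step b).weight := Finset.sum_le_sum fun b _ => ih _
      _ = growth m ^ N * ∑ b, (st.step b).weight := by rw [Finset.mul_sum]
      _ ≤ growth m ^ N * (growth m * st.weight) :=
        mul_le_mul_of_nonneg_left (sum_weight_step st) (pow_nonneg growth_nonneg N)
      _ = _ := by rw [pow_succ, mul_assoc]

lemma one_le_weight_of_not_executes {gs : List (Gen m × ℝ)} {N : ℕ} {i : Fin N → Gen m}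
    (hi : ¬ (gateRule gs).Executes i (gateProd gs)) :
    1 ≤ (progress gs (List.ofFn i)).weight := by
  obtain ⟨c, D, hc, op_eq, hD⟩ := exists_gateRule_op_eq gs i
  rcases remaining : (progress gs (List.ofFn i)).1 with _ | ⟨g, gs'⟩
  · rw [remaining, gateProd, List.map_nil, List.reverse_nil, List.prod_nil, one_mul] at hD
    exact absurd ((Rule.executes_iff _ _ _).mpr ⟨_, c, hc, hD ▸ op_eq⟩) hi
  · rw [Progress.weight, remaining, List.length_cons, pow_succ]
    linarith [one_le_pow₀ (one_le_two (α := ℝ)) (n := gs'.length)]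

lemma sum_prob {π : Rule m} (hπ : π.IsSymmetric) {L : Qubits m ⊕ Qubits m → ℂ} (hL : L ≠ 0)
    (N : ℕ) : ∑ i : Fin N → Gen m, π.prob L i = 1 := by
  simp only [prob_eq hπ hL]
  rw [Finset.sum_const, Finset.card_univ, Fintype.card_fun, Fintype.card_fin, nsmul_eq_mul,
    Nat.cast_pow, ← mul_pow,
    mul_inv_cancel₀ (Nat.cast_ne_zero.mpr Fintype.card_ne_zero), one_pow]

lemma execProb_le_one {π : Rule m} (hπ : π.IsSymmetric) {L : Qubits m ⊕ Qubits m → ℂ}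
    (hL : L ≠ 0) (N : ℕ) (V : Matrix (Qubits m ⊕ Qubits m) (Qubits m ⊕ Qubits m) ℂ) :
    π.execProb L N V ≤ 1 := by
  rw [← sum_prob hπ hL N, Rule.execProb]
  refine Finset.sum_le_sum fun i _ => Set.indicator_le_self' (fun i _ => ?_) i
  rw [prob_eq hπ hL]
  positivity

lemma le_execProb_gateRule (gs : List (Gen m × ℝ)) {L : Qubits m ⊕ Qubits m → ℂ} (hL : L ≠ 0)
    (N : ℕ) : 1 - (growth m / Fintype.card (Gen m)) ^ N * Progress.weight (gs, 0) ≤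
      (gateRule gs).execProb L N (gateProd gs) := by
  classical
  have hπ := (gateRule_isElementary gs).isSymmetric
  have total_weight_le : ∑ i : Fin N → Gen m,
      (gateRule gs).prob L i * (progress gs (List.ofFn i)).weight ≤
        (growth m / Fintype.card (Gen m)) ^ N * Progress.weight (gs, 0) := by
    simp only [prob_eq hπ hL]
    rw [← Finset.mul_sum, div_eq_inv_mul, mul_pow, mul_assoc]
    exact mul_le_mul_of_nonneg_left (sum_weight_foldl_step N _) (by positivity)
  calc _ ≤ ∑ i : Fin N → Gen m, (gateRule gs).prob L i -
        ∑ i : Fin N → Gen m, (gateRule gs).prob L i * (progress gs (List.ofFn i)).weight := by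
        rw [sum_prob hπ hL]
        exact sub_le_sub_left total_weight_le 1
    _ = ∑ i : Fin N → Gen m,
        (gateRule gs).prob L i * (1 - (progress gs (List.ofFn i)).weight) := by
      simp only [mul_sub, mul_one, Finset.sum_sub_distrib]
    _ ≤ _ := Finset.sum_le_sum fun i _ => by
      have prob_nonneg : 0 ≤ (gateRule gs).prob L i := prob_eq hπ hL i ▸ by positivity
      rw [Set.indicator_apply]
      split_ifs with hi
      · exact mul_le_of_le_one_right prob_nonneg (sub_le_self _ (Progress.weight_nonneg _))
      · exact mul_nonpos_of_nonneg_of_nonpos prob_nonneg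
          (sub_nonpos.mpr (one_le_weight_of_not_executes hi))

theorem tendsto_execProb_gateRule (gs : List (Gen m × ℝ)) {L : Qubits m ⊕ Qubits m → ℂ}
    (hL : L ≠ 0) : Tendsto (fun N => (gateRule gs).execProb L N (gateProd gs)) atTop (𝓝 1) := by
  have ratio_lt_one : growth m / Fintype.card (Gen m) < 1 :=
    (div_lt_one (by positivity)).mpr growth_lt_card
  have lower_bound_tendsto : Tendsto (fun N : ℕ => 1 -
      (growth m / Fintype.card (Gen m)) ^ N * Progress.weight (gs, 0)) atTop (𝓝 1) := by
    simpa using ((tendsto_pow_atTop_nhds_zero_of_lt_one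
      (div_nonneg growth_nonneg (Nat.cast_nonneg _)) ratio_lt_one).mul_const _).const_sub 1
  exact tendsto_of_tendsto_of_tendsto_of_le_of_le lower_bound_tendsto tendsto_const_nhds
    (le_execProb_gateRule gs hL)
    fun N => execProb_le_one (gateRule_isElementary gs).isSymmetric hL N _

theorem exists_elementary_rule {V : Matrix (Qubits m ⊕ Qubits m) (Qubits m ⊕ Qubits m) ℂ}
    (hV : V ∈ CSp (Qubits m)) : ∃ π : Rule m, π.IsElementary ∧
      ∀ L : Qubits m ⊕ Qubits m → ℂ, L ≠ 0 →
        Tendsto (fun N => π.execProb L N V) atTop (𝓝 1) := by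
  rw [← gateClosure_eq] at hV
  obtain ⟨gs, rfl⟩ := exists_gateProd_eq hV
  exact ⟨gateRule gs, gateRule_isElementary gs, fun L hL => tendsto_execProb_gateRule gs hL⟩

end SpAKLT

theorem proposition6 (m n : ℕ) (hn : n = 2 ^ m) :
    -- the AKLT state is a matrix product state
    (∀ (N : ℕ) (s : Fin N → Matrix (Qubits m ⊕ Qubits m) (Qubits m ⊕ Qubits m) ℂ),
      (∀ k, s k ∈ onSite (Qubits m)) → ∀ L : Qubits m ⊕ Qubits m → ℂ,
        contract s (aklt N L) = (List.ofFn fun k => krausOp (s k)).reverse.prod *ᵥ L) ∧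
    -- with virtual dimension `2n`, on-site dimension `n(2n+1)`,
    -- and the adjoint representation on every site
    Fintype.card (Qubits m ⊕ Qubits m) = 2 * n ∧
    Module.finrank ℂ (onSite (Qubits m)) = n * (2 * n + 1) ∧
    Set.BijOn krausOp (onSite (Qubits m) : Set (Matrix (Qubits m ⊕ Qubits m) (Qubits m ⊕ Qubits m) ℂ))
      (LieAlgebra.Symplectic.sp (Qubits m) ℂ :
        Set (Matrix (Qubits m ⊕ Qubits m) (Qubits m ⊕ Qubits m) ℂ)) ∧
    (∀ g ∈ CSp (Qubits m), ∀ s ∈ onSite (Qubits m),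
      siteSym g s ∈ onSite (Qubits m) ∧ krausOp (siteSym g s) = g * krausOp s * gᴴ) ∧
    -- the generators can be chosen as tensor products of Pauli matrices
    Submodule.span ℝ (pauliString '' (xStrings m : Set (Fin m → Fin 4))) =
      Submodule.span ℝ {A | ∃ i j : Fin (2 ^ m), i < j ∧ A = toQubits (gellMannX i j)} ∧
    Submodule.span ℝ (pauliString '' (yStrings m : Set (Fin m → Fin 4))) =
      Submodule.span ℝ {A | ∃ i j : Fin (2 ^ m), i < j ∧ A = toQubits (gellMannY i j)} ∧
    Submodule.span ℝ (pauliString '' (zStrings m : Set (Fin m → Fin 4))) =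
      Submodule.span ℝ {A | ∃ j : Fin (2 ^ m), 0 < (j : ℕ) ∧ A = toQubits (gellMannZ j)} ∧
    Fintype.card (Gen m) = n * (2 * n + 1) ∧
    (∀ a : Gen m, siteVec a ∈ onSite (Qubits m) ∧ krausOp (siteVec a) = (2 * n : ℂ)⁻¹ • gen a) ∧
    (∀ a b : Gen m, ((siteVec a)ᴴ * siteVec b).trace = if a = b then 1 else 0) ∧
    Submodule.span ℂ (Set.range (siteVec (m := m))) = onSite (Qubits m) ∧
    -- the symmetry condition
    (∀ g ∈ CSp (Qubits m), adjMatrix g ∈ Matrix.unitaryGroup (Gen m) ℂ ∧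
      ∀ a : Gen m, rotVec g a = ∑ b, starRingEnd ℂ (adjMatrix g a b) • siteVec b ∧
        ∑ b, adjMatrix g a b • gen b = gᴴ * gen a * g) ∧
    -- the numbers of commuting pairs of Pauli strings
    (∀ p ∈ xStrings m,
      4 * {q | q ∈ xStrings m ∧ Commute (pauliString p) (pauliString q)}.ncard = n ^ 2 ∧
      4 * {q | q ∈ yStrings m ∧ Commute (pauliString p) (pauliString q)}.ncard + 2 * n = n ^ 2 ∧
      2 * {q | q ∈ zStrings m ∧ Commute (pauliString p) (pauliString q)}.ncard + 2 = n) ∧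
    (∀ p ∈ yStrings m,
      4 * {q | q ∈ yStrings m ∧ Commute (pauliString p) (pauliString q)}.ncard = n ^ 2 ∧
      4 * {q | q ∈ xStrings m ∧ Commute (pauliString p) (pauliString q)}.ncard + 2 * n = n ^ 2 ∧
      2 * {q | q ∈ zStrings m ∧ Commute (pauliString p) (pauliString q)}.ncard + 2 = n) ∧
    (∀ p ∈ zStrings m,
      4 * {q | q ∈ xStrings m ∧ Commute (pauliString p) (pauliString q)}.ncard + 2 * n = n ^ 2 ∧
      4 * {q | q ∈ yStrings m ∧ Commute (pauliString p) (pauliString q)}.ncard + 2 * n = n ^ 2) ∧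
    -- all outcomes are equally likely
    (∀ (π : Rule m), π.IsSymmetric → ∀ (N : ℕ) (L : Qubits m ⊕ Qubits m → ℂ), L ≠ 0 →
      ∀ i : Fin N → Gen m, π.prob L i = ((n * (2 * n + 1) : ℝ)⁻¹) ^ N) ∧
    -- one measurement executes the gate, or the identity, up to the byproduct of the outcome;
    -- the gate succeeds exactly for the byproducts that anticommute with its generator
    (∀ (a : Gen m) (θ : ℝ), Real.sin θ ≠ 0 → ∀ b : Gen m,
      (b ∈ successes a θ ↔ gen a * gen b = -(gen b * gen a)) ∧
      (b ∉ successes a θ →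
        krausOp (rotVec (expGate a (θ / 2)) b) = (2 * n : ℂ)⁻¹ • gen b)) ∧
    -- its probability of success, given any earlier outcomes `h`
    (∀ (π : Rule m), π.IsSymmetric → ∀ (N : ℕ) (h : Fin N → Gen m) (a : Gen m) (θ : ℝ),
      π (List.ofFn h) = expGate a (θ / 2) → Real.sin θ ≠ 0 →
      ∀ L : Qubits m ⊕ Qubits m → ℂ, L ≠ 0 →
        ∑ b : Gen m, Set.indicator (successes a θ)
            (fun b => π.prob L (Fin.snoc h b : Fin (N + 1) → Gen m)) b =
          ((n + 1 : ℝ) / (2 * n + 1)) * π.prob L h) ∧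
    -- the gates form `Sp(2n)` (gates that differ by a phase being the same)
    Submonoid.closure {W | ∃ (a : Gen m) (θ : ℝ), W = expGate a θ} = CSp (Qubits m) ∧
    (∀ V ∈ CSp (Qubits m), ∃ π : Rule m, π.IsElementary ∧
      ∀ L : Qubits m ⊕ Qubits m → ℂ, L ≠ 0 →
        Tendsto (fun N => π.execProb L N V) atTop (𝓝 1)) ∧
    (∀ (π : Rule m), π.IsSymmetric → ∀ (N : ℕ) (i : Fin N → Gen m),
      ∀ V ∈ Matrix.unitaryGroup (Qubits m ⊕ Qubits m) ℂ, π.Executes i V →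
        ∃ z : ℂ, ‖z‖ = 1 ∧ z • V ∈ CSp (Qubits m)) := by
  subst hn
  have hdim : ((2 : ℂ) * ((2 ^ m : ℕ) : ℂ))⁻¹ = (2 ^ (m + 1) : ℂ)⁻¹ := by
    rw [pow_succ', Nat.cast_pow, Nat.cast_ofNat]
  refine ⟨fun N s hs L => contract_aklt s hs L, card_virtual, finrank_onSite, bijOn_krausOp,
    fun g hg s hs => ⟨siteSym_mem_onSite g hs, krausOp_siteSym hg s⟩,
    span_xStrings.trans span_toQubits_gellMannX.symm,
    span_yStrings.trans span_toQubits_gellMannY.symm,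
    span_zStrings.trans span_toQubits_gellMannZ.symm, card_gen,
    fun a => ⟨siteVec_mem a, by rw [krausOp_siteVec, hdim]⟩, trace_siteVec, span_siteVec,
    fun g hg => ⟨adjMatrix_mem_unitaryGroup hg, fun a =>
      ⟨rotVec_eq_sum hg a, sum_adjMatrix_smul_gen hg a⟩⟩,
    fun p hp => ncard_commute_of_mem_xStrings hp, fun p hp => ncard_commute_of_mem_yStrings hp,
    fun p hp => ncard_commute_of_mem_zStrings hp, ?_, ?_, ?_, gateClosure_eq,
    fun V hV => exists_elementary_rule hV,
    fun π hπ N i V hV h => exists_phase_of_executes hπ i hV h⟩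
  · intro π hπ N L hL i
    exact_mod_cast card_gen (m := m) ▸ prob_eq hπ hL i
  · intro a θ hθ b
    rw [mem_successes_iff hθ, gen_anticommute_iff]
    exact ⟨Iff.rfl, fun hb => by rw [krausOp_rotVec_expGate, if_neg hb, hdim]⟩
  · intro π hπ N h a θ _ hθ L hL
    exact_mod_cast sum_prob_successes hπ h a hθ hL
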